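/- Let $A\in\mathbb R^{n_x\times n_x}$, $B\in\mathbb R^{n_x\times n_w}$, $C\in\mathbb R^{n_y\times n_x}$, $D\in\mathbb R^{n_y\times n_w}$, $A_m\in\mathbb R^{n_m\times n_m}$, $B_m\in\mathbb R^{n_m\times n_v}$, $C_m\in\mathbb R^{n_w\times n_m}$, $D_m\in\mathbb R^{n_w\times n_v}$, and consider the plant $$\dot x=Ax+g_x(t,y)+Bw,\qquad y=Cx+g_y(t,y)+Dw,$$ whose exogenous input $w$ is generated by $$\dot x_m=A_mx_m+B_mv,\qquad w=C_mx_m+D_mv .$$ Put $$\mathcal A=\begin{bmatrix}A&BC_m\\0&A_m\end{bmatrix},\quad \mathcal B=\begin{bmatrix}BD_m\\B_m\end{bmatrix},\quad \mathcal C=\begin{bmatrix}C&DC_m\end{bmatrix},\quad \mathcal D=DD_m,\quad n_\xi=n_x+n_m .$$ For a gain $L_1\in\mathbb R^{n_\xi\times n_y}$ the observer is $$\dot{\hat\xi}=\mathcal A\hat\xi+\begin{bmatrix}g_x(t,y)\\0\end{bmatrix}+L_1(\hat y-y),\qquad \hat y=\mathcal C\hat\xi+g_y(t,y).$$ Suppose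 that $DD_m=0$, that $CBD_m+DC_mB_m$ has full column rank, and that $$\begin{bmatrix}A-\lambda I&B\\C&D\end{bmatrix}\quad\text{and}\quad\begin{bmatrix}A_m-\lambda I&B_m\\C_m&D_m\end{bmatrix}$$ have full column rank for all $\lambda\in\mathbb C$ with $\operatorname{Re}\lambda\ge0$. Then: 1. There exist matrices $\mathcal P=\mathcal P^\top\succ0$, $\mathcal Y$ and $\mathcal F$ such that $$\mathcal P\mathcal A+\mathcal A^\top\mathcal P+\mathcal Y\mathcal C+\mathcal C^\top\mathcal Y^\top\prec0,\qquad \mathcal B^\top\mathcal P=\mathcal F\mathcal C.\tag{$*$}$$ 2. Let $\mathcal P=\mathcal P^\top\succ0$, $\mathcal Y$, $\mathcal F$ be any matrices satisfying $(*)$. There is $\bar\alpha>0$ with $$\mathcal P\mathcal A+\mathcal A^\top\mathcal P+\mathcal Y\mathcal C+\mathcal C^\top\mathcal Y^\top+2\bar\alpha\mathcal P\preceq0 .$$ Let $\bar\alpha$ be any such number, $0<\alpha<\bar\alpha$, $H\in\mathbb R^{n_z\times n_\xi}$ any matrix and $\gamma>0$. There is $\mu_1>0$ with $\mu_1H^\top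 H\preceq2(\bar\alpha-\alpha)\mathcal P$; and for every such $\mu_1$ and every $\zeta\ge 1/(2\mu_1\gamma^2)$ the observer with gain $$L_1=\mathcal P^{-1}\left(\mathcal Y-\zeta\,\mathcal C^\top\mathcal F^\top\mathcal F\right)$$ generates error dynamics which, with performance output $z=He$, are globally uniformly $\mathcal L_2$-stable with performance level $\gamma$. The last assertion means the following, solutions being understood in the sense of Carathéodory. For all $g_x,g_y$ and along all trajectories of the plant, the input model and the observer on $[t_0,\infty)$, the error $e=\hat\xi-\begin{bmatrix}x\\x_m\end{bmatrix}$ satisfies $$\dot e=(\mathcal A+L_1\mathcal C)e-(\mathcal B+L_1\mathcal D)v,$$ and this system with output $z=He$ has the following properties, where $\|s(\cdot)\|_2=\left(\int_{t_0}^\infty\|s(t)\|^2\,dt\right)^{1/2}$. * For every $t_0\in\mathbb R$, every $e_0$ and every $\mathcal L_2$ input $v$ there is a solution on $[t_0,\infty)$ with $e(t_0)=e_0$. * Zero-input exponential stability: there are constants $\kappa$ and $\sigma>0$ such that every solution with $v\equiv0$ satisfies $\|e(t)\|\le\kappa e^{-\sigma(t-t_0)}\|e(t_0)\|$ for all $t\ge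 t_0$. * There is a function $\beta_1$ such that $\|e(t)\|\le\beta_1(e(t_0),\|v(\cdot)\|_2)$ for all $t_0$, all $\mathcal L_2$ inputs $v$, all solutions and all $t\ge t_0$. * There is a function $\beta_2$ such that, for all $t_0$, all $\mathcal L_2$ inputs $v$ and all solutions, $z$ is $\mathcal L_2$ and $\|z(\cdot)\|_2\le\beta_2(e(t_0),\|v(\cdot)\|_2)$; moreover $\beta_2(0,r)\le\gamma r$ for all $r\ge0$. -/

import Mathlib

open MeasureTheory

noncomputable section

namespace InputObserver

/-! ### Matrices -/

/-- A matrix has full column rank. -/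
def FullColRank {K m n : Type*} [Field K] [Fintype n] (M : Matrix m n K) : Prop :=
  M.rank = Fintype.card n

/-- The complex matrix `[[A - lam I, B], [C, D]]` attached to real matrices `A, B, C, D`. -/
def rosenbrock {n p q : ℕ} (A : Matrix (Fin n) (Fin n) ℝ) (B : Matrix (Fin n) (Fin p) ℝ)
    (C : Matrix (Fin q) (Fin n) ℝ) (D : Matrix (Fin q) (Fin p) ℝ) (lam : ℂ) :
    Matrix (Fin n ⊕ Fin q) (Fin n ⊕ Fin p) ℂ :=
  Matrix.fromBlocks (A.map Complex.ofReal - lam • (1 : Matrix (Fin n) (Fin n) ℂ))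
    (B.map Complex.ofReal) (C.map Complex.ofReal) (D.map Complex.ofReal)

/-- The augmented matrix `[[A, B C_m], [0, A_m]]`. -/
def augA {nx nm nw : ℕ} (A : Matrix (Fin nx) (Fin nx) ℝ) (B : Matrix (Fin nx) (Fin nw) ℝ)
    (Am : Matrix (Fin nm) (Fin nm) ℝ) (Cm : Matrix (Fin nw) (Fin nm) ℝ) :
    Matrix (Fin nx ⊕ Fin nm) (Fin nx ⊕ Fin nm) ℝ :=
  Matrix.fromBlocks A (B * Cm) 0 Am

/-- The augmented matrix `[B D_m; B_m]`. -/
def augB {nx nm nw nv : ℕ} (B : Matrix (Fin nx) (Fin nw) ℝ) (Bm : Matrix (Fin nm) (Fin nv) ℝ)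
    (Dm : Matrix (Fin nw) (Fin nv) ℝ) : Matrix (Fin nx ⊕ Fin nm) (Fin nv) ℝ :=
  Matrix.fromRows (B * Dm) Bm

/-- The augmented matrix `[C, D C_m]`. -/
def augC {nx nm nw ny : ℕ} (C : Matrix (Fin ny) (Fin nx) ℝ) (D : Matrix (Fin ny) (Fin nw) ℝ)
    (Cm : Matrix (Fin nw) (Fin nm) ℝ) : Matrix (Fin ny) (Fin nx ⊕ Fin nm) ℝ :=
  Matrix.fromCols C (D * Cm)

/-- `P A + Aᵀ P + Y C + Cᵀ Yᵀ + 2 a P`. -/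
def lmiPhi {n q : Type*} [Fintype n] [Fintype q] (A : Matrix n n ℝ) (C : Matrix q n ℝ)
    (P : Matrix n n ℝ) (Y : Matrix n q ℝ) (a : ℝ) : Matrix n n ℝ :=
  P * A + A.transpose * P + Y * C + C.transpose * Y.transpose + (2 * a) • P

/-- The gain `P⁻¹ (Y - zeta Cᵀ Fᵀ F)`. -/
def gain {n p q : Type*} [Fintype n] [DecidableEq n] [Fintype p] [Fintype q] (C : Matrix q n ℝ)
    (P : Matrix n n ℝ) (Y : Matrix n q ℝ) (F : Matrix p q ℝ) (zeta : ℝ) : Matrix n q ℝ :=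
  P⁻¹ * (Y - zeta • (C.transpose * F.transpose * F))

/-- A matrix acting on a vector, both vectors carrying the Euclidean norm. -/
def act {m n : Type*} [Fintype n] (M : Matrix m n ℝ) (x : EuclideanSpace ℝ n) :
    EuclideanSpace ℝ m :=
  WithLp.toLp 2 (M.mulVec x.ofLp)

/-- The stacked vector `[x; y]`. -/
def stack {m n : Type*} (x : EuclideanSpace ℝ m) (y : EuclideanSpace ℝ n) :
    EuclideanSpace ℝ (m ⊕ n) :=
  WithLp.toLp 2 (Sum.elim x.ofLp y.ofLp)

/-! ### Signals, solutions and stability -/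

section Systems

variable {E V Z : Type*} [NormedAddCommGroup E] [NormedSpace ℝ E] [NormedAddCommGroup V]
  [NormedAddCommGroup Z]

/-- A signal on `[t₀, ∞)` (only the values there matter) with `∫ ‖s t‖² dt` finite. -/
def IsL2 (t₀ : ℝ) (s : ℝ → V) : Prop := MemLp s 2 (volume.restrict (Set.Ici t₀))

/-- The `L₂` norm of a signal on `[t₀, ∞)`. -/
def l2norm (t₀ : ℝ) (s : ℝ → V) : ℝ := Real.sqrt (∫ t in Set.Ici t₀, ‖s t‖ ^ 2)

/-- `x' = φ` on `[t₀, ∞)` in the sense of Carathéodory: `x` is the integral of the locally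
integrable function `φ` (so `x` is locally absolutely continuous with derivative `φ` a.e.). -/
def HasRate (t₀ : ℝ) (x φ : ℝ → E) : Prop :=
  ∀ t, t₀ ≤ t → IntervalIntegrable φ volume t₀ t ∧ x t = x t₀ + ∫ s in t₀..t, φ s

/-- `e` solves `e' = F(t, e, v)` on `[t₀, ∞)`. -/
def IsSolution (F : ℝ → E → V → E) (t₀ : ℝ) (v : ℝ → V) (e : ℝ → E) : Prop :=
  HasRate t₀ e (fun t => F t (e t) (v t))

/-- The input-output system `e' = F(t, e, v)`, `z = G(t, e, v)` is globally uniformly `L₂`-stable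
with performance level `γ`.  The bounding functions do not depend on the initial time. -/
structure IsL2Stable (F : ℝ → E → V → E) (G : ℝ → E → V → Z) (γ : ℝ) : Prop where
  /-- Every initial condition and every `L₂` input have a response on all of `[t₀, ∞)`. -/
  exists_solution : ∀ (t₀ : ℝ) (e₀ : E) (v : ℝ → V), IsL2 t₀ v →
    ∃ e : ℝ → E, e t₀ = e₀ ∧ IsSolution F t₀ v e
  /-- Global uniform exponential stability with zero input. -/
  exp_stable : ∃ κ α : ℝ, 0 < α ∧ ∀ (t₀ : ℝ) (e : ℝ → E), IsSolution F t₀ (fun _ => 0) e →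
    ∀ t, t₀ ≤ t → ‖e t‖ ≤ κ * Real.exp (-α * (t - t₀)) * ‖e t₀‖
  /-- Global uniform boundedness of the state. -/
  bounded : ∃ β₁ : E → ℝ → ℝ, ∀ (t₀ : ℝ) (v : ℝ → V) (e : ℝ → E), IsL2 t₀ v →
    IsSolution F t₀ v e → ∀ t, t₀ ≤ t → ‖e t‖ ≤ β₁ (e t₀) (l2norm t₀ v)
  /-- Output response. -/
  output : ∃ β₂ : E → ℝ → ℝ,
    (∀ (t₀ : ℝ) (v : ℝ → V) (e : ℝ → E), IsL2 t₀ v → IsSolution F t₀ v e →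
      IsL2 t₀ (fun t => G t (e t) (v t)) ∧
      l2norm t₀ (fun t => G t (e t) (v t)) ≤ β₂ (e t₀) (l2norm t₀ v)) ∧
    ∀ r : ℝ, 0 ≤ r → β₂ 0 r ≤ γ * r

end Systems

/-! ### Plant, exogenous input model, observer -/

/-- Trajectories on `[t₀, ∞)` of the plant `x' = A x + g_x(t,y) + B w`,
`y = C x + g_y(t,y) + D w`. -/
structure IsPlantTrajectory {nx nw ny : ℕ} (A : Matrix (Fin nx) (Fin nx) ℝ)
    (B : Matrix (Fin nx) (Fin nw) ℝ) (C : Matrix (Fin ny) (Fin nx) ℝ)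
    (D : Matrix (Fin ny) (Fin nw) ℝ)
    (gx : ℝ → EuclideanSpace ℝ (Fin ny) → EuclideanSpace ℝ (Fin nx))
    (gy : ℝ → EuclideanSpace ℝ (Fin ny) → EuclideanSpace ℝ (Fin ny)) (t₀ : ℝ)
    (w : ℝ → EuclideanSpace ℝ (Fin nw)) (x : ℝ → EuclideanSpace ℝ (Fin nx))
    (y : ℝ → EuclideanSpace ℝ (Fin ny)) : Prop where
  state : HasRate t₀ x (fun t => act A (x t) + gx t (y t) + act B (w t))
  output : ∀ t, t₀ ≤ t → y t = act C (x t) + gy t (y t) + act D (w t)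

/-- Trajectories on `[t₀, ∞)` of the exogenous input model `x_m' = A_m x_m + B_m v`,
`w = C_m x_m + D_m v`. -/
structure IsModelTrajectory {nm nw nv : ℕ} (Am : Matrix (Fin nm) (Fin nm) ℝ)
    (Bm : Matrix (Fin nm) (Fin nv) ℝ) (Cm : Matrix (Fin nw) (Fin nm) ℝ)
    (Dm : Matrix (Fin nw) (Fin nv) ℝ) (t₀ : ℝ) (v : ℝ → EuclideanSpace ℝ (Fin nv))
    (xm : ℝ → EuclideanSpace ℝ (Fin nm)) (w : ℝ → EuclideanSpace ℝ (Fin nw)) : Prop where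
  state : HasRate t₀ xm (fun t => act Am (xm t) + act Bm (v t))
  output : ∀ t, t₀ ≤ t → w t = act Cm (xm t) + act Dm (v t)

/-- Trajectories on `[t₀, ∞)` of the observer `ξ' = 𝒜 ξ + [g_x(t,y); 0] + L (η - y)`,
`η = 𝒞 ξ + g_y(t,y)`, driven by the measured output `y`; here `ξ` is the state estimate and
`η` the output estimate. -/
structure IsObserverTrajectory {nx nm ny : ℕ}
    (cA : Matrix (Fin nx ⊕ Fin nm) (Fin nx ⊕ Fin nm) ℝ) (cC : Matrix (Fin ny) (Fin nx ⊕ Fin nm) ℝ)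
    (L : Matrix (Fin nx ⊕ Fin nm) (Fin ny) ℝ)
    (gx : ℝ → EuclideanSpace ℝ (Fin ny) → EuclideanSpace ℝ (Fin nx))
    (gy : ℝ → EuclideanSpace ℝ (Fin ny) → EuclideanSpace ℝ (Fin ny)) (t₀ : ℝ)
    (y : ℝ → EuclideanSpace ℝ (Fin ny)) (ξ : ℝ → EuclideanSpace ℝ (Fin nx ⊕ Fin nm))
    (η : ℝ → EuclideanSpace ℝ (Fin ny)) : Prop where
  state : HasRate t₀ ξ (fun t => act cA (ξ t) + stack (gx t (y t)) 0 + act L (η t - y t))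
  output : ∀ t, t₀ ≤ t → η t = act cC (ξ t) + gy t (y t)

/-- Right-hand side of the error dynamics `e' = (𝒜 + L 𝒞) e - (ℬ + L 𝒟) v`. -/
def errorRHS {n q p : Type*} [Fintype n] [Fintype q] [Fintype p] (cA : Matrix n n ℝ)
    (cB : Matrix n p ℝ) (cC : Matrix q n ℝ) (cD : Matrix q p ℝ) (L : Matrix n q ℝ) :
    ℝ → EuclideanSpace ℝ n → EuclideanSpace ℝ p → EuclideanSpace ℝ n :=
  fun _ e v => act (cA + L * cC) e - act (cB + L * cD) v

/-- The observer with gain `L` generates error dynamics that, with performance output `z = H e`,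
are globally uniformly `L₂`-stable with performance level `γ`: for all `g_x`, `g_y`, along all
trajectories of plant, exogenous input model and observer the error `e = ξ̂ - [x; x_m]` solves the
linear error system, and that system is `L₂`-stable with level `γ`. -/
def ObserverAchieves {nx nm nw nv ny nz : ℕ} (A : Matrix (Fin nx) (Fin nx) ℝ)
    (B : Matrix (Fin nx) (Fin nw) ℝ) (C : Matrix (Fin ny) (Fin nx) ℝ)
    (D : Matrix (Fin ny) (Fin nw) ℝ) (Am : Matrix (Fin nm) (Fin nm) ℝ)
    (Bm : Matrix (Fin nm) (Fin nv) ℝ) (Cm : Matrix (Fin nw) (Fin nm) ℝ)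
    (Dm : Matrix (Fin nw) (Fin nv) ℝ) (H : Matrix (Fin nz) (Fin nx ⊕ Fin nm) ℝ)
    (L : Matrix (Fin nx ⊕ Fin nm) (Fin ny) ℝ) (γ : ℝ) : Prop :=
  (∀ (gx : ℝ → EuclideanSpace ℝ (Fin ny) → EuclideanSpace ℝ (Fin nx))
    (gy : ℝ → EuclideanSpace ℝ (Fin ny) → EuclideanSpace ℝ (Fin ny)) (t₀ : ℝ)
    (v : ℝ → EuclideanSpace ℝ (Fin nv)) (xm : ℝ → EuclideanSpace ℝ (Fin nm))
    (w : ℝ → EuclideanSpace ℝ (Fin nw)) (x : ℝ → EuclideanSpace ℝ (Fin nx))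
    (y : ℝ → EuclideanSpace ℝ (Fin ny)) (ξ : ℝ → EuclideanSpace ℝ (Fin nx ⊕ Fin nm))
    (η : ℝ → EuclideanSpace ℝ (Fin ny)),
    IsModelTrajectory Am Bm Cm Dm t₀ v xm w → IsPlantTrajectory A B C D gx gy t₀ w x y →
    IsObserverTrajectory (augA A B Am Cm) (augC C D Cm) L gx gy t₀ y ξ η →
    IsSolution (errorRHS (augA A B Am Cm) (augB B Bm Dm) (augC C D Cm) (D * Dm) L) t₀ v
      (fun t => ξ t - stack (x t) (xm t))) ∧
  IsL2Stable (errorRHS (augA A B Am Cm) (augB B Bm Dm) (augC C D Cm) (D * Dm) L)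
    (fun _ e _ => act H e) γ

end InputObserver

end

namespace InputObserver

open Matrix Filter Topology
open scoped ComplexOrder

/-! ### Linear algebra: detectability, minimum phase and the matrix inequality -/

section Algebra

variable {n : Type*} [Fintype n]

/-! Existence. Write `A, B, C` for the augmented matrices. The two Rosenbrock conditions together
with `D * Dm = 0` make the augmented system minimum phase (`eq_zero_of_rosenbrock`), and the
remaining rank condition says that `C * B` has a left inverse `G`. Put `R = 1 - B G C`, so that `R B
= 0`. Minimum phase then says exactly what is needed for the pair `(C, R A)` to be detectable, and
detectability yields `Q > 0` solving the Lyapunov-type inequality for `R A`. The matrix `P = (G C)ᵀ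
(G C) + Rᵀ Q R` satisfies `Bᵀ P = G C`, and `P A` differs from `Q R A` by a term `Cᵀ Z`, which is
absorbed into `Y`.

The detectability step (`exists_posDef_lmi_of_detectable`) is convex duality: if the inequality had
no solution, Hahn-Banach would give a nonzero `X ≥ 0` with `C X = 0` and `M X + X Mᵀ ≥ 0`. The range
of such an `X` is invariant under `M` and contains an unobservable eigenvector with `Re lam ≥ 0`.

Performance. With `V = eᵀ P e`, completing a square turns the lower bound on `zeta` into `V' + 2 a V
≤ μ (γ² |v|² - |z|²)` (`gain_dissipative`). Integrating this inequality gives the stability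
properties (`isL2Stable_of_dissipative`). Since `V` is only absolutely continuous along a solution,
the integration uses Lebesgue differentiation. -/

theorem FullColRank.eq_zero {K m n : Type*} [Field K] [Fintype n] {M : Matrix m n K}
    (hM : FullColRank M) {x : n → K} (hx : M *ᵥ x = 0) : x = 0 := by
  have h := LinearMap.finrank_range_add_finrank_ker M.mulVecLin
  have hr : Module.finrank K (LinearMap.range M.mulVecLin) = Fintype.card n := hM
  rw [hr, Module.finrank_fintype_fun_eq_card] at h
  have hk : LinearMap.ker M.mulVecLin = ⊥ := Submodule.finrank_eq_zero.1 (by omega)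
  have : x ∈ LinearMap.ker M.mulVecLin := hx
  simpa [hk] using this

theorem FullColRank.exists_left_inverse {K m n : Type*} [Field K] [Fintype m] [Fintype n]
    [DecidableEq n] {M : Matrix m n K} (hM : FullColRank M) : ∃ G : Matrix n m K, G * M = 1 := by
  classical
  obtain ⟨g, hg⟩ := LinearMap.exists_leftInverse_of_injective (Matrix.toLin' M)
    (LinearMap.ker_eq_bot'.2 fun x hx => hM.eq_zero (by simpa using hx))
  refine ⟨LinearMap.toMatrix' g, ?_⟩
  have := congrArg LinearMap.toMatrix' hg
  simpa [LinearMap.toMatrix'_comp] using this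

/-- By homogeneity it suffices to test the compact unit sphere. Symmetry is deliberately not
imposed: the positive definite matrices themselves need not be open among all matrices. -/
theorem isOpen_setOf_forall_dotProduct_mulVec_pos :
    IsOpen {N : Matrix n n ℝ | ∀ x : n → ℝ, x ≠ 0 → 0 < x ⬝ᵥ N *ᵥ x} := by
  have heq : {N : Matrix n n ℝ | ∀ x : n → ℝ, x ≠ 0 → 0 < x ⬝ᵥ N *ᵥ x} =
      {N : Matrix n n ℝ | ∀ x ∈ Metric.sphere (0 : n → ℝ) 1, 0 < x ⬝ᵥ N *ᵥ x} := by
    ext N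
    refine ⟨fun h x hx => h x fun h0 => by simp [h0] at hx, fun h x hx => ?_⟩
    have hpos : 0 < ‖x‖ := norm_pos_iff.2 hx
    have := h (‖x‖⁻¹ • x) (by simp [norm_smul, hpos.ne'])
    rw [mulVec_smul, dotProduct_smul, smul_dotProduct, smul_eq_mul, smul_eq_mul] at this
    exact pos_of_mul_pos_right (pos_of_mul_pos_right this (by positivity)) (by positivity)
  rw [heq, isOpen_iff_eventually]
  intro N hN
  refine (isCompact_sphere (0 : n → ℝ) 1).eventually_forall_of_forall_eventually fun x hx => ?_
  have hc : Continuous fun z : Matrix n n ℝ × (n → ℝ) => z.2 ⬝ᵥ z.1 *ᵥ z.2 := by fun_prop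
  exact hc.continuousAt.eventually_const_lt (hN x hx)

/-- Strict definiteness survives small perturbations. This supplies `abar`, `μ₁` and the comparison
constants between `P` and the Euclidean norm. -/
theorem _root_.Matrix.PosDef.exists_posDef_sub_smul {N S : Matrix n n ℝ} (hN : N.PosDef)
    (hS : S.IsHermitian) : ∃ ε : ℝ, 0 < ε ∧ (N - ε • S).PosDef := by
  have hc : Tendsto (fun ε : ℝ => N - ε • S) (𝓝[>] 0) (𝓝 N) := by
    have : Continuous fun ε : ℝ => N - ε • S := by fun_prop
    simpa using this.continuousWithinAt.tendsto (s := Set.Ioi 0) (x := 0)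
  have hev := hc.eventually (isOpen_setOf_forall_dotProduct_mulVec_pos.mem_nhds
    (fun x hx => by simpa using hN.dotProduct_mulVec_pos hx))
  obtain ⟨ε, hε, hpos⟩ := (hev.and self_mem_nhdsWithin).exists
  refine ⟨ε, hpos, .of_dotProduct_mulVec_pos (hN.1.sub ?_) fun x hx => by simpa using hε x hx⟩
  rw [IsHermitian, conjTranspose_smul, hS.eq, star_trivial]

theorem map_ofReal_mul {a b c : Type*} [Fintype b] (K : Matrix a b ℝ) (L : Matrix b c ℝ) :
    (K * L).map Complex.ofReal = K.map Complex.ofReal * L.map Complex.ofReal :=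
  Matrix.map_mul (f := Complex.ofRealHom)

theorem posSemidef_map_ofReal {N : Matrix n n ℝ} (hN : N.PosSemidef) :
    (N.map Complex.ofReal).PosSemidef := by
  classical
  obtain ⟨R, rfl⟩ : ∃ R : Matrix n n ℝ, N = Rᴴ * R := by
    open scoped MatrixOrder in
    exact CStarAlgebra.nonneg_iff_eq_star_mul_self.mp hN.nonneg
  rw [map_ofReal_mul]
  have : Rᴴ.map Complex.ofReal = (R.map Complex.ofReal)ᴴ := by ext i j; simp
  rw [this]
  exact posSemidef_conjTranspose_mul_self _

/-- A positive semidefinite `X` supported in the unobservable directions with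
`M X + X Mᵀ` positive semidefinite produces an unstable unobservable mode. -/
theorem eq_zero_of_posSemidef_of_detectable {q : Type*} [DecidableEq n] {M : Matrix n n ℝ} {C : Matrix q n ℝ}
    (h : ∀ lam : ℂ, 0 ≤ lam.re → ∀ u : n → ℂ, M.map Complex.ofReal *ᵥ u = lam • u →
      C.map Complex.ofReal *ᵥ u = 0 → u = 0) {X : Matrix n n ℝ} (hX : X.PosSemidef)
    (hCX : C * X = 0) (hMX : (M * X + X * Mᵀ).PosSemidef) : X = 0 := by
  have hXt : Xᵀ = X := by simpa using hX.1.eq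
  -- For `z` in the kernel of `X`, the form of `M X + X Mᵀ` vanishes at `z`; semidefiniteness then
  -- puts `z` in the kernel of the matrix itself.
  have hker : ∀ z : n → ℝ, X *ᵥ z = 0 → (X * Mᵀ) *ᵥ z = 0 := by
    intro z hz
    have hz' : z ᵥ* X = 0 := by rw [← hXt, vecMul_transpose, hz]
    have := (hMX.dotProduct_mulVec_zero_iff z).1 (by
      rw [star_trivial, add_mulVec, dotProduct_add, ← mulVec_mulVec, hz, mulVec_zero,
        dotProduct_mulVec z (X * Mᵀ), ← vecMul_vecMul, hz']
      simp)
    simpa [add_mulVec, ← mulVec_mulVec, hz] using this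
  -- By `hker`, `X * Mᵀ` factors through `X` on the left; transposing the factorisation shows that
  -- the range of `X` is `M`-invariant.
  obtain ⟨S, hS⟩ : ∃ S : Matrix n n ℝ, M * X = X * S := by
    obtain ⟨g, hg⟩ : ∃ g : (n → ℝ) →ₗ[ℝ] (n → ℝ), g ∘ₗ toLin' X = toLin' (X * Mᵀ) := by
      obtain ⟨s, hs⟩ := (toLin' X).rangeRestrict.exists_rightInverse_of_surjective
        (LinearMap.range_rangeRestrict _)
      obtain ⟨g, hg⟩ := LinearMap.exists_extend (toLin' (X * Mᵀ) ∘ₗ s)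
      refine ⟨g, LinearMap.ext fun z => ?_⟩
      have h1 : g (toLin' X z) = (toLin' (X * Mᵀ) ∘ₗ s) ((toLin' X).rangeRestrict z) := by
        rw [← hg]; rfl
      have h2 : toLin' X (s ((toLin' X).rangeRestrict z)) = toLin' X z := by
        have := LinearMap.congr_fun hs ((toLin' X).rangeRestrict z)
        exact congrArg Subtype.val this
      rw [LinearMap.comp_apply, h1, LinearMap.comp_apply, ← sub_eq_zero, ← map_sub]
      refine hker _ ?_
      rw [mulVec_sub, sub_eq_zero]
      exact h2
    refine ⟨(LinearMap.toMatrix' g)ᵀ, ?_⟩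
    have := congrArg (fun f => (LinearMap.toMatrix' f)ᵀ) hg
    simpa [LinearMap.toMatrix'_comp, hXt] using this.symm
  set Xc : Matrix n n ℂ := X.map Complex.ofReal with hXc
  set Mc : Matrix n n ℂ := M.map Complex.ofReal with hMc
  have hS' : Mc * Xc = Xc * S.map Complex.ofReal := by rw [hMc, hXc, ← map_ofReal_mul, hS, map_ofReal_mul]
  by_contra hne
  have hnt : Nontrivial (LinearMap.range (toLin' Xc)) := by
    rw [Submodule.nontrivial_iff_ne_bot, Ne, LinearMap.range_eq_bot]
    intro h0
    have : Xc = 0 := by simpa using h0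
    refine hne (Matrix.ext fun i j => ?_)
    simpa [hXc] using congrFun (congrFun this i) j
  have hinv : ∀ y ∈ LinearMap.range (toLin' Xc), toLin' Mc y ∈ LinearMap.range (toLin' Xc) := by
    rintro _ ⟨u, rfl⟩
    refine ⟨S.map Complex.ofReal *ᵥ u, ?_⟩
    simp only [toLin'_apply, mulVec_mulVec, hS']
  obtain ⟨lam, hlam⟩ := Module.End.exists_eigenvalue ((toLin' Mc).restrict hinv)
  obtain ⟨⟨y, u, hu⟩, hy, hy0⟩ := hlam.exists_hasEigenvector
  have hy1 : Mc *ᵥ y = lam • y := congrArg Subtype.val (Module.End.mem_eigenspace_iff.1 hy)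
  have hyne : y ≠ 0 := fun h0 => hy0 (Subtype.ext h0)
  replace hu : Xc *ᵥ u = y := hu
  refine hyne (h lam ?_ y hy1 ?_)
  -- For `y = X u` the form of `M X + X Mᵀ` at `u` is `2 Re(lam)` times that of `X`, which is
  -- positive at `u`.
  · have hX0 := (posSemidef_map_ofReal hX).dotProduct_mulVec_nonneg u
    have hXne : star u ⬝ᵥ Xc *ᵥ u ≠ 0 := fun h0 =>
      hyne (hu ▸ ((posSemidef_map_ofReal hX).dotProduct_mulVec_zero_iff u).1 h0)
    have hM0 := (posSemidef_map_ofReal hMX).dotProduct_mulVec_nonneg u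
    have hXh : Xcᴴ = Xc := (posSemidef_map_ofReal hX).1
    have e1 : star u ⬝ᵥ (Mc * Xc) *ᵥ u = lam * (star u ⬝ᵥ Xc *ᵥ u) := by
      rw [← mulVec_mulVec, hu, hy1, dotProduct_smul, smul_eq_mul]
    have e2 : star u ⬝ᵥ (Xc * Mcᴴ) *ᵥ u = star (lam * (star u ⬝ᵥ Xc *ᵥ u)) := by
      rw [← e1, star_dotProduct, star_mulVec, ← dotProduct_mulVec, conjTranspose_mul,
        conjTranspose_conjTranspose, hXh]
    have e3 : (M * X + X * Mᵀ).map Complex.ofReal = Mc * Xc + Xc * Mcᴴ := by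
      have : Mcᴴ = Mᵀ.map Complex.ofReal := by ext i j; simp [hMc]
      rw [this, hMc, hXc, ← map_ofReal_mul, ← map_ofReal_mul]
      ext i j; simp
    rw [e3, add_mulVec, dotProduct_add, e1, e2] at hM0
    obtain ⟨hr, hi⟩ := Complex.nonneg_iff.1 hX0
    have hrpos : 0 < (star u ⬝ᵥ Xc *ᵥ u).re :=
      lt_of_le_of_ne hr fun h0 => hXne (Complex.ext h0.symm hi.symm)
    have := (Complex.nonneg_iff.1 hM0).1
    have hi' : (star u ⬝ᵥ Xc *ᵥ u).im = 0 := hi.symm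
    simp only [Complex.star_def, Complex.add_re, Complex.conj_re, Complex.mul_re, hi', mul_zero,
      sub_zero] at this
    exact nonneg_of_mul_nonneg_left (by linarith) hrpos
  · rw [← hu, mulVec_mulVec, hXc, ← map_ofReal_mul, hCX]
    ext; simp [mulVec, dotProduct]

/-- A detectable pair `(C, M)` admits a strict quadratic certificate. -/
theorem exists_posDef_lmi_of_detectable {q : Type*} [Fintype q] [DecidableEq n] {M : Matrix n n ℝ} {C : Matrix q n ℝ}
    (h : ∀ lam : ℂ, 0 ≤ lam.re → ∀ u : n → ℂ, M.map Complex.ofReal *ᵥ u = lam • u →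
      C.map Complex.ofReal *ᵥ u = 0 → u = 0) :
    ∃ (Q : Matrix n n ℝ) (Y : Matrix n q ℝ), Q.PosDef ∧
      (-(Q * M + Mᵀ * Q + Y * C + Cᵀ * Yᵀ)).PosDef := by
  classical
  by_contra hcon
  push Not at hcon
  -- An open convex cone in the space of all matrices, without symmetry. Elements of `t` are
  -- symmetric, so disjointness is still equivalent to the failure of the claim.
  set s : Set (Matrix n n ℝ) := {N | ∀ x : n → ℝ, x ≠ 0 → 0 < x ⬝ᵥ (-N) *ᵥ x} with hs
  set t : Set (Matrix n n ℝ) := {N | ∃ (Q : Matrix n n ℝ) (Y : Matrix n q ℝ), Q.PosDef ∧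
      N = Q * M + Mᵀ * Q + Y * C + Cᵀ * Yᵀ} with ht
  have hsymm : ∀ (Q : Matrix n n ℝ) (Y : Matrix n q ℝ), Qᵀ = Q →
      (Q * M + Mᵀ * Q + Y * C + Cᵀ * Yᵀ)ᵀ = Q * M + Mᵀ * Q + Y * C + Cᵀ * Yᵀ := by
    intro Q Y hQ
    simp only [transpose_add, transpose_mul, transpose_transpose, hQ]
    abel
  have hs_open : IsOpen s :=
    (isOpen_setOf_forall_dotProduct_mulVec_pos (n := n)).preimage continuous_neg
  have hs_conv : Convex ℝ s := by
    intro N hN K hK a b ha hb hab x hx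
    have h1 := hN x hx
    have h2 := hK x hx
    have : x ⬝ᵥ (-(a • N + b • K)) *ᵥ x = a * (x ⬝ᵥ (-N) *ᵥ x) + b * (x ⬝ᵥ (-K) *ᵥ x) := by
      simp [neg_mulVec, add_mulVec, smul_mulVec]
      ring
    rw [this]
    rcases ha.eq_or_lt with rfl | ha'
    · have : b = 1 := by linarith
      subst this; linarith
    · have := mul_pos ha' h1
      have := mul_nonneg hb h2.le
      linarith
  have ht_conv : Convex ℝ t := by
    rintro _ ⟨Q, Y, hQ, rfl⟩ _ ⟨Q', Y', hQ', rfl⟩ a b ha hb hab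
    refine ⟨a • Q + b • Q', a • Y + b • Y', ?_, ?_⟩
    · rcases ha.eq_or_lt with rfl | ha'
      · have : b = 1 := by linarith
        subst this; simpa using hQ'
      · exact (hQ.smul ha').add_posSemidef (hQ'.posSemidef.smul hb)
    · simp only [transpose_add, transpose_smul, Matrix.add_mul, Matrix.mul_add, Matrix.smul_mul,
        Matrix.mul_smul, smul_add]
      abel
  have hdisj : Disjoint s t := by
    rw [Set.disjoint_left]
    rintro _ hN ⟨Q, Y, hQ, rfl⟩
    refine hcon Q Y hQ (.of_dotProduct_mulVec_pos ?_ fun x hx => by simpa using hN x hx)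
    rw [IsHermitian, conjTranspose_eq_transpose_of_trivial, transpose_neg]
    rw [hsymm Q Y (by simpa using hQ.1.eq)]
  obtain ⟨f, c, hfs, hft⟩ := geometric_hahn_banach_open hs_conv hs_open ht_conv hdisj
  have hone : (-1 : Matrix n n ℝ) ∈ s := fun x hx => by
    simpa using (dotProduct_star_self_pos_iff (v := x)).2 hx
  have hscale : ∀ N ∈ s, ∀ r : ℝ, 0 < r → r • N ∈ s := by
    intro N hN r hr x hx
    have := mul_pos hr (hN x hx)
    simpa [neg_mulVec, smul_mulVec] using this
  -- `s` is a cone: scaling up shows that `f` cannot be positive on it, and scaling down (to reach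
  -- the value `c / 2`) shows that `c` cannot be negative.
  have hf_nonpos : ∀ N ∈ s, f N ≤ 0 := by
    intro N hN
    by_contra! hpos
    have := hfs _ (hscale N hN ((|c| + 1) / f N) (by positivity))
    rw [map_smul, smul_eq_mul, div_mul_cancel₀ _ hpos.ne'] at this
    linarith [le_abs_self c]
  have hc : 0 ≤ c := by
    by_contra! hneg
    have hlt := hfs _ hone
    have := hfs _ (hscale _ hone (c / (2 * f (-1)))
      (div_pos_of_neg_of_neg hneg (by linarith)))
    rw [map_smul, smul_eq_mul] at this
    have e : c / (2 * f (-1)) * f (-1) = c / 2 := by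
      have : f (-1) ≠ 0 := by linarith
      field_simp
    linarith
  have hf_nonneg : ∀ N ∈ t, 0 ≤ f N := fun N hN => hc.trans (hft N hN)
  -- the symmetric matrix representing `f` on symmetric matrices
  set X : Matrix n n ℝ := of fun i j => f (single i j 1) + f (single j i 1) with hX
  have hXt : Xᵀ = X := by ext i j; simp [hX, add_comm]
  have hfX : ∀ N : Matrix n n ℝ, Nᵀ = N → 2 * f N = (X * N).trace := by
    intro N hN
    have h1 : f N = ∑ i, ∑ j, N i j * f (single i j 1) := by
      conv_lhs => rw [matrix_eq_sum_single N]
      simp only [map_sum]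
      refine Finset.sum_congr rfl fun i _ => Finset.sum_congr rfl fun j _ => ?_
      rw [← smul_eq_mul, ← map_smul, smul_single, smul_eq_mul, mul_one]
    have hN' : ∀ i j, N j i = N i j := fun i j => congrFun (congrFun hN i) j
    have h2 : f N = ∑ i, ∑ j, N i j * f (single j i 1) := by
      rw [h1, Finset.sum_comm]
      exact Finset.sum_congr rfl fun i _ => Finset.sum_congr rfl fun j _ => by rw [hN']
    have h3 : (X * N).trace = ∑ i, ∑ j, N i j * (f (single i j 1) + f (single j i 1)) := by
      simp only [trace, diag, mul_apply, hX, of_apply]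
      exact Finset.sum_congr rfl fun i _ => Finset.sum_congr rfl fun j _ => by rw [hN', mul_comm]
    rw [h3, two_mul]
    nth_rw 1 [h1]
    rw [h2, ← Finset.sum_add_distrib]
    refine Finset.sum_congr rfl fun i _ => ?_
    rw [← Finset.sum_add_distrib]
    exact Finset.sum_congr rfl fun j _ => (mul_add _ _ _).symm
  have htr : ∀ (K : Matrix n n ℝ) (z : n → ℝ), (K * vecMulVec z z).trace = z ⬝ᵥ K *ᵥ z := by
    intro K z
    rw [mul_vecMulVec, trace_vecMulVec, dotProduct_comm]
  have hpd : ∀ (z : n → ℝ) (ε : ℝ), 0 < ε → (vecMulVec z z + ε • (1 : Matrix n n ℝ)).PosDef := by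
    intro z ε hε
    have := posSemidef_vecMulVec_self_star z
    rw [star_trivial] at this
    exact PosDef.posSemidef_add this (PosDef.one.smul hε)
  -- Admissible `Q` must be definite, while the useful test matrices `0` and `z zᵀ` are only
  -- semidefinite; they are shifted by `ε • 1` and `ε` tends to zero.
  have hlim : ∀ a b : ℝ, (∀ ε : ℝ, 0 < ε → 0 ≤ a + ε * b) → 0 ≤ a := by
    intro a b hab
    by_contra! ha
    have := hab (-a / (2 * (|b| + 1))) (div_pos (by linarith) (by positivity))
    have h2 : -a / (2 * (|b| + 1)) * b ≤ -a / 2 := by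
      rw [div_mul_eq_mul_div, div_le_div_iff₀ (by positivity) (by norm_num)]
      nlinarith [le_abs_self b]
    linarith
  have hXpsd : X.PosSemidef := by
    refine .of_dotProduct_mulVec_nonneg (by simpa [IsHermitian] using hXt) fun z => ?_
    rw [star_trivial, ← htr]
    refine hlim _ X.trace fun ε hε => ?_
    have hmem : -(vecMulVec z z + ε • (1 : Matrix n n ℝ)) ∈ s := fun x hx => by
      simpa using (hpd z ε hε).dotProduct_mulVec_pos hx
    have h1 := hf_nonpos _ hmem
    have h2 := hfX (vecMulVec z z + ε • (1 : Matrix n n ℝ)) (by simp)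
    rw [map_neg] at h1
    rw [Matrix.mul_add, trace_add, Matrix.mul_smul, trace_smul, Matrix.mul_one, smul_eq_mul] at h2
    linarith
  have hCX : C * X = 0 := by
    have key : ∀ Y : Matrix n q ℝ, 0 ≤ (C * X * Y).trace := by
      intro Y
      refine hlim _ ((X * (1 * M + Mᵀ * 1)).trace / 2) fun ε hε => ?_
      have h1 := hf_nonneg _ ⟨ε • 1, Y, PosDef.one.smul hε, rfl⟩
      have h2 := hfX _ (hsymm (ε • 1) Y (by simp))
      have e1 : (X * (Y * C)).trace = (C * X * Y).trace := by
        rw [← Matrix.mul_assoc, trace_mul_comm, Matrix.mul_assoc]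
      have e2 : (X * (Cᵀ * Yᵀ)).trace = (C * X * Y).trace := by
        rw [← e1, ← trace_transpose, transpose_mul, transpose_mul, transpose_transpose,
          transpose_transpose, hXt, trace_mul_comm]
      rw [add_assoc, Matrix.mul_add, trace_add, Matrix.mul_add X (Y * C), trace_add, e1, e2,
        Matrix.smul_mul, Matrix.mul_smul, ← smul_add, Matrix.mul_smul, trace_smul,
        smul_eq_mul] at h2
      rw [add_assoc, Matrix.smul_mul, Matrix.mul_smul, ← smul_add] at h1
      linarith
    -- A linear functional of `Y` that is never negative vanishes; this choice of `Y` makes it minus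
    -- the squared Frobenius norm of `C * X`.
    have h0 := key (-(C * X)ᵀ)
    rw [Matrix.mul_neg, trace_neg] at h0
    have h1 : (C * X * (C * X)ᴴ).trace = 0 := by
      rw [conjTranspose_eq_transpose_of_trivial]
      have := (posSemidef_self_mul_conjTranspose (C * X)).trace_nonneg
      rw [conjTranspose_eq_transpose_of_trivial] at this
      linarith
    exact trace_mul_conjTranspose_self_eq_zero_iff.1 h1
  have hMX : (M * X + X * Mᵀ).PosSemidef := by
    refine .of_dotProduct_mulVec_nonneg ?_ fun z => ?_
    · rw [IsHermitian, conjTranspose_eq_transpose_of_trivial, transpose_add, transpose_mul,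
        transpose_mul, transpose_transpose, hXt, add_comm]
    rw [star_trivial, ← htr]
    refine hlim _ (M * X + X * Mᵀ).trace fun ε hε => ?_
    have h1 := hf_nonneg _ ⟨_, 0, hpd z ε hε, rfl⟩
    have h2 := hfX _ (hsymm (vecMulVec z z + ε • (1 : Matrix n n ℝ)) 0 (by simp))
    have e1 : ∀ Q : Matrix n n ℝ, (X * (Q * M + Mᵀ * Q)).trace = ((M * X + X * Mᵀ) * Q).trace := by
      intro Q
      rw [Matrix.mul_add, Matrix.add_mul, trace_add, trace_add, ← Matrix.mul_assoc,
        trace_mul_comm (X * Q), Matrix.mul_assoc M, Matrix.mul_assoc X]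
    rw [Matrix.zero_mul, transpose_zero, Matrix.mul_zero, add_zero, add_zero, e1,
      Matrix.mul_add (M * X + X * Mᵀ), trace_add, Matrix.mul_smul, trace_smul, Matrix.mul_one, smul_eq_mul] at h2
    rw [Matrix.zero_mul, transpose_zero, Matrix.mul_zero, add_zero, add_zero] at h1
    linarith
  have hX0 := eq_zero_of_posSemidef_of_detectable h hXpsd hCX hMX
  have hf0 : ∀ N : Matrix n n ℝ, Nᵀ = N → f N = 0 := fun N hN => by
    have := hfX N hN
    rw [hX0, Matrix.zero_mul, trace_zero] at this
    linarith
  have h1 := hf0 (-1) (by simp)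
  have h2 := hfs _ hone
  have h3 := hft _ ⟨1, 0, PosDef.one, rfl⟩
  have h4 := hf0 _ (hsymm 1 0 (by simp))
  linarith

/-- A minimum phase system `(A, B, C)` for which `C B` has full column rank can be rendered
strictly passive by output injection. -/
theorem exists_posDef_lmi_of_minimumPhase {p q : Type*} [Fintype p] [Fintype q]
    [DecidableEq n] [DecidableEq p] {A : Matrix n n ℝ}
    {B : Matrix n p ℝ} {C : Matrix q n ℝ} (hCB : FullColRank (C * B))
    (h : ∀ lam : ℂ, 0 ≤ lam.re → ∀ (u : n → ℂ) (v : p → ℂ),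
      A.map Complex.ofReal *ᵥ u + B.map Complex.ofReal *ᵥ v = lam • u →
      C.map Complex.ofReal *ᵥ u = 0 → u = 0) :
    ∃ (P : Matrix n n ℝ) (Y : Matrix n q ℝ) (F : Matrix p q ℝ), P.PosDef ∧
      (-lmiPhi A C P Y 0).PosDef ∧ Bᵀ * P = F * C := by
  obtain ⟨G, hG⟩ := hCB.exists_left_inverse
  set R : Matrix n n ℝ := 1 - B * (G * C) with hR
  have hRB : R * B = 0 := by
    rw [hR, Matrix.sub_mul, Matrix.one_mul, Matrix.mul_assoc, Matrix.mul_assoc, hG,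
      Matrix.mul_one, sub_self]
  -- If `R A u = lam u` and `C u = 0`, then the input `-G C A u` realises `u` as a zero direction of
  -- `(A, B, C)`.
  obtain ⟨Q, Y, hQ, hLMI⟩ := exists_posDef_lmi_of_detectable (M := R * A) (C := C) (by
    intro lam hlam u hu hCu
    refine h lam hlam u (-((G * C * A).map Complex.ofReal *ᵥ u)) ?_ hCu
    rw [← hu, mulVec_neg, mulVec_mulVec, ← map_ofReal_mul, ← sub_eq_add_neg, ← sub_mulVec]
    congr 1
    rw [hR, Matrix.sub_mul, Matrix.one_mul, Matrix.mul_assoc B]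
    ext i j; simp)
  have hQt : Qᵀ = Q := by simpa using hQ.1.eq
  -- The first summand of `P` controls the part of `x` that `R` kills. The correction to `Y` cancels
  -- the terms by which `P A` differs from `Q R A`.
  refine ⟨(G * C)ᵀ * (G * C) + Rᵀ * Q * R,
    Y - ((G.transpose * (G * C * A) - (B * G)ᵀ * Q * R * A))ᵀ, G, ?_, ?_, ?_⟩
  · refine .of_dotProduct_mulVec_pos ?_ fun x hx => ?_
    · rw [IsHermitian, conjTranspose_eq_transpose_of_trivial]
      simp only [transpose_add, transpose_mul, transpose_transpose, hQt, Matrix.mul_assoc]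
    · have e : ∀ K : Matrix p n ℝ, star x ⬝ᵥ (Kᵀ * K + Rᵀ * Q * R) *ᵥ x =
          (K *ᵥ x) ⬝ᵥ (K *ᵥ x) + (R *ᵥ x) ⬝ᵥ Q *ᵥ (R *ᵥ x) := by
        intro K
        simp only [star_trivial, add_mulVec, dotProduct_add, ← mulVec_mulVec, dotProduct_mulVec x,
          vecMul_transpose]
      rw [e]
      have h1 : 0 ≤ ((G * C) *ᵥ x) ⬝ᵥ ((G * C) *ᵥ x) := by
        simpa using dotProduct_star_self_nonneg ((G * C) *ᵥ x)
      by_cases hRx : R *ᵥ x = 0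
      · have hK : (G * C) *ᵥ x ≠ 0 := by
          intro hK
          refine hx ?_
          rw [hR, sub_mulVec, one_mulVec, ← mulVec_mulVec, hK, mulVec_zero, sub_zero] at hRx
          exact hRx
        have h2 : 0 < ((G * C) *ᵥ x) ⬝ᵥ ((G * C) *ᵥ x) := by
          simpa using (dotProduct_star_self_pos_iff (v := (G * C) *ᵥ x)).2 hK
        rw [hRx]; simpa using h2
      · have h2 : 0 < (R *ᵥ x) ⬝ᵥ Q *ᵥ (R *ᵥ x) := by simpa using hQ.dotProduct_mulVec_pos hRx
        linarith
  · convert hLMI using 2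
    simp only [lmiPhi, mul_zero, zero_smul, add_zero]
    have hPA : ((G * C)ᵀ * (G * C) + Rᵀ * Q * R) * A =
        Q * (R * A) + Cᵀ * (G.transpose * (G * C * A) - (B * G)ᵀ * Q * R * A) := by
      have : Rᵀ = 1 - Cᵀ * (B * G)ᵀ := by
        rw [hR, transpose_sub, transpose_one, ← Matrix.mul_assoc, transpose_mul (B * G)]
      rw [this]
      simp only [transpose_mul, Matrix.add_mul, Matrix.sub_mul, Matrix.mul_sub, Matrix.one_mul,
        Matrix.mul_assoc]
      abel
    have hAP : Aᵀ * ((G * C)ᵀ * (G * C) + Rᵀ * Q * R) =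
        (((G * C)ᵀ * (G * C) + Rᵀ * Q * R) * A)ᵀ := by
      simp only [transpose_add, transpose_mul, transpose_transpose, hQt, Matrix.mul_assoc]
    rw [hAP, hPA]
    generalize G.transpose * (G * C * A) - (B * G)ᵀ * Q * R * A = Z
    simp only [transpose_add, transpose_sub, transpose_mul, transpose_transpose, hQt,
      Matrix.sub_mul, Matrix.mul_sub, Matrix.mul_assoc]
    abel
  · have e1 : Bᵀ * (G * C)ᵀ = 1 := by
      rw [← transpose_mul, Matrix.mul_assoc, hG, transpose_one]
    have e2 : Bᵀ * Rᵀ = 0 := by rw [← transpose_mul, hRB, transpose_zero]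
    rw [Matrix.mul_add, ← Matrix.mul_assoc, e1, Matrix.one_mul, Matrix.mul_assoc Rᵀ,
      ← Matrix.mul_assoc Bᵀ, e2, Matrix.zero_mul, add_zero]

end Algebra

end InputObserver

namespace InputObserver

open Matrix Filter Topology

/-! ### Carathéodory solutions and linear equations -/

section Rates

theorem continuousOn_Ici_of_continuousOn_Icc {X : Type*} [TopologicalSpace X] {t₀ : ℝ} {f : ℝ → X}
    (h : ∀ t, t₀ ≤ t → ContinuousOn f (Set.Icc t₀ t)) : ContinuousOn f (Set.Ici t₀) := by
  intro s hs
  have hs' : t₀ ≤ s := hs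
  refine (h (s + 1) (by linarith) s ⟨hs, by linarith⟩).mono_of_mem_nhdsWithin ?_
  rw [← Set.Ici_inter_Iic]
  exact inter_mem_nhdsWithin _ (Iic_mem_nhds (by linarith))

variable {E G : Type*} [NormedAddCommGroup E] [NormedSpace ℝ E] [NormedAddCommGroup G]
  [NormedSpace ℝ G] {t₀ : ℝ} {x y φ ψ : ℝ → E}

theorem HasRate.map [CompleteSpace E] [CompleteSpace G] (T : E →L[ℝ] G) (h : HasRate t₀ x φ) :
    HasRate t₀ (fun t => T (x t)) (fun t => T (φ t)) := by
  intro t ht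
  obtain ⟨hi, he⟩ := h t ht
  exact ⟨⟨T.integrable_comp hi.1, T.integrable_comp hi.2⟩, by
    beta_reduce
    rw [T.intervalIntegral_comp_comm hi, he, map_add]⟩

theorem HasRate.add (hx : HasRate t₀ x φ) (hy : HasRate t₀ y ψ) :
    HasRate t₀ (fun t => x t + y t) (fun t => φ t + ψ t) := by
  intro t ht
  obtain ⟨hi, he⟩ := hx t ht
  obtain ⟨hi', he'⟩ := hy t ht
  refine ⟨hi.add hi', ?_⟩
  beta_reduce
  rw [intervalIntegral.integral_add hi hi', he, he']
  abel

theorem HasRate.sub (hx : HasRate t₀ x φ) (hy : HasRate t₀ y ψ) :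
    HasRate t₀ (fun t => x t - y t) (fun t => φ t - ψ t) := by
  intro t ht
  obtain ⟨hi, he⟩ := hx t ht
  obtain ⟨hi', he'⟩ := hy t ht
  refine ⟨hi.sub hi', ?_⟩
  beta_reduce
  rw [intervalIntegral.integral_sub hi hi', he, he']
  abel

theorem HasRate.congr (hx : HasRate t₀ x φ) (hφ : ∀ t, t₀ ≤ t → φ t = ψ t) : HasRate t₀ x ψ := by
  intro t ht
  obtain ⟨hi, he⟩ := hx t ht
  have heq : Set.EqOn φ ψ (Set.uIcc t₀ t) := fun s hs => by
    rw [Set.uIcc_of_le ht] at hs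
    exact hφ s hs.1
  exact ⟨hi.congr (heq.mono Set.uIoc_subset_uIcc), by
    rw [he, intervalIntegral.integral_congr heq]⟩

theorem continuousOn_Ici_primitive (h : ∀ t, t₀ ≤ t → IntervalIntegrable φ volume t₀ t) :
    ContinuousOn (fun t => ∫ s in t₀..t, φ s) (Set.Ici t₀) := by
  refine continuousOn_Ici_of_continuousOn_Icc fun t ht => ?_
  have := intervalIntegral.continuousOn_primitive_interval' (h t ht) Set.left_mem_uIcc
  rwa [Set.uIcc_of_le ht] at this

theorem HasRate.continuousOn (h : HasRate t₀ x φ) : ContinuousOn x (Set.Ici t₀) :=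
  (continuousOn_const.add (continuousOn_Ici_primitive fun t ht => (h t ht).1)).congr
    fun t ht => (h t ht).2

/-- As `b` is only integrable, its primitive `W` is split off: `u = e - W` solves `u' = A u + A W`
with continuous forcing, where variation of constants gives a classical solution. -/
theorem exists_hasRate_linear [CompleteSpace E] (A : E →L[ℝ] E) {b : ℝ → E}
    (hb : ∀ t, t₀ ≤ t → IntervalIntegrable b volume t₀ t) (e₀ : E) :
    ∃ e : ℝ → E, e t₀ = e₀ ∧ HasRate t₀ e (fun t => A (e t) + b t) := by
  let +nondep : NormedAlgebra ℚ (E →L[ℝ] E) := .restrictScalars ℚ ℝ _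
  -- Freezing `W` to the left of `t₀` makes it continuous on the whole line.
  set W : ℝ → E := fun t => ∫ s in t₀..max t t₀, b s with hW
  have hWc : Continuous W :=
    (continuousOn_Ici_primitive hb).comp_continuous (by fun_prop) fun t => le_max_right t t₀
  have hWeq : ∀ t, t₀ ≤ t → W t = ∫ s in t₀..t, b s := fun t ht => by
    simp only [hW, max_eq_left ht]
  have hexp : ∀ t, HasDerivAt (fun s : ℝ => NormedSpace.exp ((s - t₀) • A))
      (A * NormedSpace.exp ((t - t₀) • A)) t := fun t => by
    have := (hasDerivAt_exp_smul_const' (𝕂 := ℝ) A (t - t₀)).scomp t ((hasDerivAt_id t).sub_const t₀)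
    rw [one_smul] at this
    exact this
  have hexpn : Continuous fun s : ℝ => NormedSpace.exp (-((s - t₀) • A)) := by
    have : Continuous fun s : ℝ => -((s - t₀) • A) := by fun_prop
    exact NormedSpace.exp_continuous.comp this
  set k : ℝ → E := fun s => NormedSpace.exp (-((s - t₀) • A)) (A (W s)) with hk
  have hkc : Continuous k := hexpn.clm_apply (A.continuous.comp hWc)
  set u : ℝ → E := fun t => NormedSpace.exp ((t - t₀) • A) (e₀ + ∫ s in t₀..t, k s) with hu
  have hud : ∀ t, HasDerivAt u (A (u t) + A (W t)) t := by
    intro t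
    have h1 : HasDerivAt (fun t => e₀ + ∫ s in t₀..t, k s) (k t) t :=
      (intervalIntegral.integral_hasDerivAt_right (hkc.intervalIntegrable _ _)
        hkc.stronglyMeasurable.stronglyMeasurableAtFilter hkc.continuousAt).const_add e₀
    have h2 := (hexp t).clm_apply h1
    convert h2 using 1
    have hinv : NormedSpace.exp ((t - t₀) • A) * NormedSpace.exp (-((t - t₀) • A)) = 1 := by
      rw [← NormedSpace.exp_add_of_commute (Commute.neg_right (Commute.refl _)), add_neg_cancel,
        NormedSpace.exp_zero]
    have h3 : NormedSpace.exp ((t - t₀) • A) (k t) = A (W t) := by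
      have := congrArg (fun T : E →L[ℝ] E => T (A (W t))) hinv
      simpa using this
    rw [h3]
    rfl
  have huc : Continuous u := continuous_iff_continuousAt.2 fun t => (hud t).continuousAt
  refine ⟨fun t => W t + u t, ?_, ?_⟩
  · simp [hW, hu, NormedSpace.exp_zero]
  · have hWr : HasRate t₀ W b := fun t ht => ⟨hb t ht, by
      rw [hWeq t ht, hWeq t₀ le_rfl]; simp⟩
    have hur : HasRate t₀ u (fun t => A (u t) + A (W t)) := fun t ht => by
      have hc : Continuous fun t => A (u t) + A (W t) :=
        (A.continuous.comp huc).add (A.continuous.comp hWc)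
      refine ⟨hc.intervalIntegrable _ _, ?_⟩
      rw [intervalIntegral.integral_eq_sub_of_hasDerivAt (fun s _ => hud s)
        (hc.intervalIntegrable _ _)]
      abel
    refine (hWr.add hur).congr fun t _ => ?_
    rw [map_add]
    abel

end Rates

/-! ### Matrices acting on Euclidean vectors -/

section Act

variable {m n : Type*} [Fintype n]

theorem act_add (M : Matrix m n ℝ) (x y : EuclideanSpace ℝ n) : act M (x + y) = act M x + act M y := by
  simp [act, mulVec_add]

theorem act_smul (M : Matrix m n ℝ) (c : ℝ) (x : EuclideanSpace ℝ n) :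
    act M (c • x) = c • act M x := by
  simp [act, mulVec_smul]

theorem act_sub (M : Matrix m n ℝ) (x y : EuclideanSpace ℝ n) : act M (x - y) = act M x - act M y := by
  simp [act, mulVec_sub]

/-- The continuous linear map attached to a matrix. -/
noncomputable def actL [Fintype m] (M : Matrix m n ℝ) : EuclideanSpace ℝ n →L[ℝ] EuclideanSpace ℝ m :=
  LinearMap.toContinuousLinearMap
    { toFun := act M, map_add' := act_add M, map_smul' := act_smul M }

theorem norm_sq_eq_dotProduct (x : EuclideanSpace ℝ n) : ‖x‖ ^ 2 = x.ofLp ⬝ᵥ x.ofLp := by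
  rw [EuclideanSpace.norm_sq_eq]
  simp [dotProduct, sq]

end Act

/-! ### Quadratic forms along absolutely continuous curves -/

section Energy

variable {n : Type*} [Fintype n]

theorem absolutelyContinuousOnInterval_const (c a b : ℝ) :
    AbsolutelyContinuousOnInterval (fun _ : ℝ => c) a b :=
  ((LipschitzWith.const c).lipschitzOnWith (s := Set.uIcc a b)).absolutelyContinuousOnInterval

theorem absolutelyContinuousOnInterval_sum {ι : Type*} (s : Finset ι) {f : ι → ℝ → ℝ} {a b : ℝ}
    (h : ∀ i ∈ s, AbsolutelyContinuousOnInterval (f i) a b) :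
    AbsolutelyContinuousOnInterval (fun t => ∑ i ∈ s, f i t) a b := by
  classical
  induction s using Finset.induction_on with
  | empty => simpa using absolutelyContinuousOnInterval_const 0 a b
  | insert i s hi ih =>
    simp only [Finset.sum_insert hi]
    exact (h i (Finset.mem_insert_self i s)).fun_add
      (ih fun j hj => h j (Finset.mem_insert_of_mem hj))

theorem AbsolutelyContinuousOnInterval.sub_le_integral {f h : ℝ → ℝ} {a b : ℝ} (hab : a ≤ b)
    (hf : AbsolutelyContinuousOnInterval f a b) (hh : IntervalIntegrable h volume a b)
    (hle : ∀ᵐ t, t ∈ Set.Icc a b → deriv f t ≤ h t) : f b - f a ≤ ∫ t in a..b, h t := by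
  rw [← hf.integral_deriv_eq_sub]
  refine intervalIntegral.integral_mono_ae_restrict hab hf.intervalIntegrable_deriv hh ?_
  exact (ae_restrict_iff' measurableSet_Icc).2 hle

/-- Comparison principle for a quadratic form along an absolutely continuous curve. -/
theorem HasRate.exp_mul_quadratic_le {t₀ c t : ℝ} {e φ : ℝ → EuclideanSpace ℝ n}
    (he : HasRate t₀ e φ) {P : Matrix n n ℝ} (hP : Pᵀ = P) {h : ℝ → ℝ} (ht : t₀ ≤ t)
    (hh : IntervalIntegrable h volume t₀ t)
    (hle : ∀ s, t₀ ≤ s → 2 * ((φ s).ofLp ⬝ᵥ P *ᵥ (e s).ofLp) +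
      c * ((e s).ofLp ⬝ᵥ P *ᵥ (e s).ofLp) ≤ h s) :
    Real.exp (c * (t - t₀)) * ((e t).ofLp ⬝ᵥ P *ᵥ (e t).ofLp) ≤
      (e t₀).ofLp ⬝ᵥ P *ᵥ (e t₀).ofLp + ∫ s in t₀..t, Real.exp (c * (s - t₀)) * h s := by
  have hproj : ∀ i, HasRate t₀ (fun s => (e s).ofLp i) (fun s => (φ s).ofLp i) := fun i =>
    he.map (EuclideanSpace.proj (𝕜 := ℝ) i)
  have hinti : ∀ i, IntervalIntegrable (fun s => (φ s).ofLp i) volume t₀ t :=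
    fun i => (hproj i t ht).1
  -- `e` is unconstrained before `t₀`. The curve `g` follows the integral formula on both sides, so
  -- two-sided derivatives can be used.
  set g : ℝ → EuclideanSpace ℝ n := fun s =>
    WithLp.toLp 2 fun i => (e t₀).ofLp i + ∫ r in t₀..s, (φ r).ofLp i with hg
  have hge : ∀ s, t₀ ≤ s → g s = e s := fun s hs => by
    ext i
    exact (hproj i s hs).2.symm
  have hgi : ∀ i, AbsolutelyContinuousOnInterval (fun s => (g s).ofLp i) t₀ t := fun i =>
    (absolutelyContinuousOnInterval_const _ t₀ t).fun_add
      ((hinti i).absolutelyContinuousOnInterval_intervalIntegral Set.left_mem_uIcc)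
  set f : ℝ → ℝ := fun s => Real.exp (c * (s - t₀)) * ((g s).ofLp ⬝ᵥ P *ᵥ (g s).ofLp) with hf
  have hfac : AbsolutelyContinuousOnInterval f t₀ t := by
    have h1 : AbsolutelyContinuousOnInterval (fun s => Real.exp (c * (s - t₀))) t₀ t :=
      ContDiffOn.absolutelyContinuousOnInterval (by fun_prop)
    refine h1.fun_mul ?_
    simp only [dotProduct, mulVec]
    exact absolutelyContinuousOnInterval_sum _ fun i _ => (hgi i).fun_mul
      (absolutelyContinuousOnInterval_sum _ fun j _ => (hgi j).const_mul _)
  have hder : ∀ᵐ s, s ∈ Set.Icc t₀ t → deriv f s ≤ Real.exp (c * (s - t₀)) * h s := by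
    -- Lebesgue differentiation, applied to each of the finitely many coordinates.
    have hae := ae_all_iff.2 fun i => (hinti i).ae_hasDerivAt_integral
    rw [Set.uIcc_of_le ht] at hae
    filter_upwards [hae] with s hs hst
    have hgdi : ∀ i, HasDerivAt (fun s => (g s).ofLp i) ((φ s).ofLp i) s := fun i =>
      (hs i hst t₀ ⟨le_rfl, ht⟩).const_add _
    have hV : HasDerivAt (fun s => (g s).ofLp ⬝ᵥ P *ᵥ (g s).ofLp)
        (2 * ((φ s).ofLp ⬝ᵥ P *ᵥ (g s).ofLp)) s := by
      have h1 : HasDerivAt (fun s => (g s).ofLp ⬝ᵥ P *ᵥ (g s).ofLp)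
          ((φ s).ofLp ⬝ᵥ P *ᵥ (g s).ofLp + (g s).ofLp ⬝ᵥ P *ᵥ (φ s).ofLp) s := by
        simp only [dotProduct, mulVec, ← Finset.sum_add_distrib]
        refine HasDerivAt.fun_sum fun i _ => (hgdi i).mul (HasDerivAt.fun_sum fun j _ => ?_)
        exact (hgdi j).const_mul _
      convert h1 using 1
      rw [dotProduct_mulVec (g s).ofLp, ← mulVec_transpose, hP, dotProduct_comm (P *ᵥ _), two_mul]
    have hE : HasDerivAt (fun s => Real.exp (c * (s - t₀))) (Real.exp (c * (s - t₀)) * c) s := by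
      simpa using (((hasDerivAt_id s).sub_const t₀).const_mul c).exp
    have hfd : HasDerivAt f _ s := hE.mul hV
    rw [hfd.deriv]
    have := mul_le_mul_of_nonneg_left (hle s hst.1) (Real.exp_pos (c * (s - t₀))).le
    rw [hge s hst.1]
    linarith
  have hexpc : Continuous fun s => Real.exp (c * (s - t₀)) := by fun_prop
  have := AbsolutelyContinuousOnInterval.sub_le_integral ht hfac
    (hh.continuousOn_mul hexpc.continuousOn) hder
  simp only [hf, hge t ht, hge t₀ le_rfl, sub_self, mul_zero, Real.exp_zero, one_mul] at this
  linarith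

end Energy

/-! ### Dissipation implies `L₂`-stability -/

section Stability

variable {n p z : Type*} [Fintype n] [Fintype p] [Fintype z]

theorem IsL2.integrableOn_norm_sq {V : Type*} [NormedAddCommGroup V] {t₀ : ℝ} {v : ℝ → V}
    (hv : IsL2 t₀ v) : IntegrableOn (fun s => ‖v s‖ ^ 2) (Set.Ici t₀) :=
  hv.integrable_norm_pow two_ne_zero

theorem IsL2.intervalIntegrable_norm_sq {V : Type*} [NormedAddCommGroup V] {t₀ t : ℝ} {v : ℝ → V}
    (hv : IsL2 t₀ v) (ht : t₀ ≤ t) : IntervalIntegrable (fun s => ‖v s‖ ^ 2) volume t₀ t := by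
  rw [intervalIntegrable_iff_integrableOn_Icc_of_le ht]
  exact hv.integrableOn_norm_sq.mono_set Set.Icc_subset_Ici_self

theorem IsL2.intervalIntegrable {V : Type*} [NormedAddCommGroup V] {t₀ t : ℝ} {v : ℝ → V}
    (hv : IsL2 t₀ v) (ht : t₀ ≤ t) : IntervalIntegrable v volume t₀ t := by
  rw [intervalIntegrable_iff_integrableOn_Icc_of_le ht]
  have : MemLp v 2 (volume.restrict (Set.Icc t₀ t)) :=
    hv.mono_measure (Measure.restrict_mono Set.Icc_subset_Ici_self le_rfl)
  exact this.integrable one_le_two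

theorem sq_l2norm {V : Type*} [NormedAddCommGroup V] (t₀ : ℝ) (v : ℝ → V) :
    l2norm t₀ v ^ 2 = ∫ s in Set.Ici t₀, ‖v s‖ ^ 2 :=
  Real.sq_sqrt (integral_nonneg fun _ => by positivity)

theorem IsL2.intervalIntegral_norm_sq_le {V : Type*} [NormedAddCommGroup V] {t₀ t : ℝ} {v : ℝ → V}
    (hv : IsL2 t₀ v) (ht : t₀ ≤ t) : ∫ s in t₀..t, ‖v s‖ ^ 2 ≤ l2norm t₀ v ^ 2 := by
  rw [sq_l2norm, intervalIntegral.integral_of_le ht]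
  exact setIntegral_mono_set hv.integrableOn_norm_sq (ae_of_all _ fun _ => by positivity)
    (Set.Ioc_subset_Icc_self.trans Set.Icc_subset_Ici_self).eventuallyLE

/-- Integrals of a nonnegative function over growing intervals pass to the limit; continuity
supplies measurability. -/
theorem isL2_and_sq_l2norm_le {V : Type*} [NormedAddCommGroup V] {t₀ K : ℝ} {v : ℝ → V}
    (hc : ContinuousOn v (Set.Ici t₀)) (hK : ∀ t, t₀ ≤ t → ∫ s in t₀..t, ‖v s‖ ^ 2 ≤ K) :
    IsL2 t₀ v ∧ l2norm t₀ v ^ 2 ≤ K := by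
  have hc2 : ContinuousOn (fun s => ‖v s‖ ^ 2) (Set.Ici t₀) := hc.norm.pow 2
  have hint : IntegrableOn (fun s => ‖v s‖ ^ 2) (Set.Ioi t₀) := by
    refine integrableOn_Ioi_of_intervalIntegral_norm_bounded (l := atTop) (b := id) K t₀
      (fun t => ?_) tendsto_id ?_
    · exact ((hc2.mono Set.Icc_subset_Ici_self).integrableOn_Icc).mono_set Set.Ioc_subset_Icc_self
    · filter_upwards [eventually_ge_atTop t₀] with t ht
      simpa using hK t ht
  refine ⟨(memLp_two_iff_integrable_sq_norm
    (hc.aestronglyMeasurable measurableSet_Ici)).2 ?_, ?_⟩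
  · exact (integrableOn_Ici_iff_integrableOn_Ioi (by simp)).2 hint
  · rw [sq_l2norm, integral_Ici_eq_integral_Ioi]
    refine le_of_tendsto (intervalIntegral_tendsto_integral_Ioi t₀ hint tendsto_id) ?_
    filter_upwards [eventually_ge_atTop t₀] with t ht
    exact hK t ht

/-- `V = xᵀ P x` is a storage function. Dropping `2 a V` and integrating bounds both the state and
the output energy; keeping it as the weight `exp (2 a t)` with `v = 0` gives exponential decay. -/
theorem isL2Stable_of_dissipative {M P : Matrix n n ℝ} {N : Matrix n p ℝ} {H : Matrix z n ℝ}
    {a μ γ : ℝ} (hP : P.PosDef) (ha : 0 < a) (hμ : 0 < μ) (hγ : 0 < γ)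
    (hdiss : ∀ (x : n → ℝ) (v : p → ℝ), 2 * ((M *ᵥ x - N *ᵥ v) ⬝ᵥ P *ᵥ x) +
      2 * a * (x ⬝ᵥ P *ᵥ x) ≤ μ * γ ^ 2 * (v ⬝ᵥ v) - μ * ((H *ᵥ x) ⬝ᵥ (H *ᵥ x))) :
    IsL2Stable (fun (_ : ℝ) (e : EuclideanSpace ℝ n) (v : EuclideanSpace ℝ p) =>
      act M e - act N v) (fun _ e _ => act H e) γ := by
  classical
  have hPt : Pᵀ = P := by simpa using hP.1.eq
  have hV0 : ∀ x : n → ℝ, 0 ≤ x ⬝ᵥ P *ᵥ x := fun x => by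
    simpa using hP.posSemidef.dotProduct_mulVec_nonneg x
  obtain ⟨l, hl, hlP⟩ := hP.exists_posDef_sub_smul (S := 1) isHermitian_one
  obtain ⟨k, hk, hkP⟩ := (PosDef.one (n := n) (R := ℝ)).exists_posDef_sub_smul hP.1
  have hlow : ∀ x : EuclideanSpace ℝ n, l * ‖x‖ ^ 2 ≤ x.ofLp ⬝ᵥ P *ᵥ x.ofLp := fun x => by
    have := hlP.posSemidef.dotProduct_mulVec_nonneg x.ofLp
    rw [star_trivial, sub_mulVec, dotProduct_sub, smul_mulVec, one_mulVec, dotProduct_smul,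
      ← norm_sq_eq_dotProduct, smul_eq_mul] at this
    linarith
  have hupp : ∀ x : EuclideanSpace ℝ n, k * (x.ofLp ⬝ᵥ P *ᵥ x.ofLp) ≤ ‖x‖ ^ 2 := fun x => by
    have := hkP.posSemidef.dotProduct_mulVec_nonneg x.ofLp
    rw [star_trivial, sub_mulVec, dotProduct_sub, smul_mulVec, one_mulVec, dotProduct_smul,
      ← norm_sq_eq_dotProduct, smul_eq_mul] at this
    linarith
  have hdissE : ∀ (x : EuclideanSpace ℝ n) (v : EuclideanSpace ℝ p),
      2 * ((act M x - act N v).ofLp ⬝ᵥ P *ᵥ x.ofLp) + 2 * a * (x.ofLp ⬝ᵥ P *ᵥ x.ofLp) ≤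
        μ * γ ^ 2 * ‖v‖ ^ 2 - μ * ‖act H x‖ ^ 2 := fun x v => by
    rw [norm_sq_eq_dotProduct, norm_sq_eq_dotProduct]
    exact hdiss x.ofLp v.ofLp
  have henergy : ∀ (t₀ : ℝ) (v : ℝ → EuclideanSpace ℝ p) (e : ℝ → EuclideanSpace ℝ n),
      IsL2 t₀ v → HasRate t₀ e (fun t => act M (e t) - act N (v t)) → ∀ t, t₀ ≤ t →
      (e t).ofLp ⬝ᵥ P *ᵥ (e t).ofLp + μ * ∫ s in t₀..t, ‖act H (e s)‖ ^ 2 ≤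
        (e t₀).ofLp ⬝ᵥ P *ᵥ (e t₀).ofLp + μ * γ ^ 2 * l2norm t₀ v ^ 2 := by
    intro t₀ v e hv he t ht
    have hz : IntervalIntegrable (fun s => ‖act H (e s)‖ ^ 2) volume t₀ t := by
      refine ContinuousOn.intervalIntegrable ?_
      rw [Set.uIcc_of_le ht]
      exact (((actL H).continuous.comp_continuousOn he.continuousOn).norm.pow 2).mono
        Set.Icc_subset_Ici_self
    have hv2 := hv.intervalIntegrable_norm_sq ht
    have h1 := he.exp_mul_quadratic_le (c := 0) hPt
      (h := fun s => μ * γ ^ 2 * ‖v s‖ ^ 2 - μ * ‖act H (e s)‖ ^ 2) ht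
      ((hv2.const_mul _).sub (hz.const_mul _)) fun s _ => by
        have h1 := hdissE (e s) (v s)
        have h2 := mul_nonneg ha.le (hV0 (e s).ofLp)
        linarith
    simp only [zero_mul, Real.exp_zero, one_mul] at h1
    rw [intervalIntegral.integral_sub (hv2.const_mul _) (hz.const_mul _),
      intervalIntegral.integral_const_mul, intervalIntegral.integral_const_mul] at h1
    have h2 := mul_le_mul_of_nonneg_left (hv.intervalIntegral_norm_sq_le ht)
      (show 0 ≤ μ * γ ^ 2 by positivity)
    linarith
  refine ⟨?_, ?_, ?_, ?_⟩
  · intro t₀ e₀ v hv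
    obtain ⟨e, he0, he⟩ := exists_hasRate_linear (t₀ := t₀) (actL M) (b := fun s => -actL N (v s))
      (fun t ht => by
        have := hv.intervalIntegrable ht
        exact IntervalIntegrable.neg ⟨(actL N).integrable_comp this.1,
          (actL N).integrable_comp this.2⟩) e₀
    exact ⟨e, he0, he.congr fun t _ => (sub_eq_add_neg _ _).symm⟩
  -- `V` decays at rate `2 a`, hence the norm at rate `a`; the constant comes from `l ≤ P` and `k P
  -- ≤ 1`.
  · refine ⟨Real.sqrt (1 / (k * l)), a, ha, fun t₀ e he t ht => ?_⟩
    have h1 := HasRate.exp_mul_quadratic_le he (c := 2 * a) hPt (h := fun _ => 0) ht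
      (by simp) fun s _ => by
        have h1 := hdissE (e s) 0
        have h2 : 0 ≤ μ * ‖act H (e s)‖ ^ 2 := by positivity
        simp only [norm_zero] at h1
        linarith
    simp only [mul_zero, intervalIntegral.integral_zero, add_zero] at h1
    have h2 := hlow (e t)
    have h3 := hupp (e t₀)
    have hE : Real.exp (2 * a * (t - t₀)) * Real.exp (-a * (t - t₀)) ^ 2 = 1 := by
      rw [← Real.exp_nat_mul, ← Real.exp_add]
      simp; ring
    refine le_of_sq_le_sq ?_ (by positivity)
    rw [mul_pow, mul_pow, Real.sq_sqrt (by positivity)]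
    have h4 : k * l * ‖e t‖ ^ 2 ≤ Real.exp (-a * (t - t₀)) ^ 2 * ‖e t₀‖ ^ 2 := by
      set E := Real.exp (2 * a * (t - t₀))
      set D := Real.exp (-a * (t - t₀)) ^ 2 with hD
      have hD0 : 0 ≤ D := by positivity
      calc k * l * ‖e t‖ ^ 2 = k * (l * ‖e t‖ ^ 2) := by ring
        _ ≤ k * ((e t).ofLp ⬝ᵥ P *ᵥ (e t).ofLp) := mul_le_mul_of_nonneg_left h2 hk.le
        _ = k * D * (E * ((e t).ofLp ⬝ᵥ P *ᵥ (e t).ofLp)) := by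
          linear_combination (-k * ((e t).ofLp ⬝ᵥ P *ᵥ (e t).ofLp)) * hE
        _ ≤ k * D * ((e t₀).ofLp ⬝ᵥ P *ᵥ (e t₀).ofLp) :=
          mul_le_mul_of_nonneg_left h1 (by positivity)
        _ = D * (k * ((e t₀).ofLp ⬝ᵥ P *ᵥ (e t₀).ofLp)) := by ring
        _ ≤ D * ‖e t₀‖ ^ 2 := mul_le_mul_of_nonneg_left h3 hD0
    rw [mul_assoc, div_mul_eq_mul_div, one_mul, le_div_iff₀ (by positivity)]
    linarith
  · refine ⟨fun e₀ r => Real.sqrt ((e₀.ofLp ⬝ᵥ P *ᵥ e₀.ofLp + μ * γ ^ 2 * r ^ 2) / l),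
      fun t₀ v e hv he t ht => Real.le_sqrt_of_sq_le ?_⟩
    rw [le_div_iff₀ hl]
    have h1 := henergy t₀ v e hv he t ht
    have h2 : 0 ≤ μ * ∫ s in t₀..t, ‖act H (e s)‖ ^ 2 :=
      mul_nonneg hμ.le (intervalIntegral.integral_nonneg ht fun _ _ => by positivity)
    linarith [hlow (e t)]
  -- The energy bound divided by `μ`; at `e₀ = 0` only `γ ^ 2 * r ^ 2` is left under the root.
  · refine ⟨fun e₀ r => Real.sqrt ((e₀.ofLp ⬝ᵥ P *ᵥ e₀.ofLp) / μ + γ ^ 2 * r ^ 2),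
      fun t₀ v e hv he => ?_, fun r hr => ?_⟩
    · have hz : ContinuousOn (fun s => act H (e s)) (Set.Ici t₀) :=
        (actL H).continuous.comp_continuousOn (HasRate.continuousOn he)
      have := isL2_and_sq_l2norm_le hz
        (K := ((e t₀).ofLp ⬝ᵥ P *ᵥ (e t₀).ofLp) / μ + γ ^ 2 * l2norm t₀ v ^ 2) fun t ht => by
          have h1 := henergy t₀ v e hv he t ht
          have h2 := hV0 (e t).ofLp
          rw [div_add' _ _ _ hμ.ne', le_div_iff₀ hμ]
          linarith
      exact ⟨this.1, Real.le_sqrt_of_sq_le this.2⟩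
    · simp only [WithLp.ofLp_zero, zero_dotProduct, zero_div, zero_add]
      rw [← mul_pow, Real.sqrt_sq (by positivity)]

end Stability

end InputObserver

namespace InputObserver

open Matrix

/-! ### The augmented system and its error dynamics -/

section Observer

variable {nx nm nw nv ny : ℕ} {A : Matrix (Fin nx) (Fin nx) ℝ} {B : Matrix (Fin nx) (Fin nw) ℝ}
  {C : Matrix (Fin ny) (Fin nx) ℝ} {D : Matrix (Fin ny) (Fin nw) ℝ} {Am : Matrix (Fin nm) (Fin nm) ℝ}
  {Bm : Matrix (Fin nm) (Fin nv) ℝ} {Cm : Matrix (Fin nw) (Fin nm) ℝ} {Dm : Matrix (Fin nw) (Fin nv) ℝ}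

theorem rosenbrock_mulVec_elim {n p q : ℕ} (A : Matrix (Fin n) (Fin n) ℝ)
    (B : Matrix (Fin n) (Fin p) ℝ) (C : Matrix (Fin q) (Fin n) ℝ) (D : Matrix (Fin q) (Fin p) ℝ)
    (lam : ℂ) (x : Fin n → ℂ) (w : Fin p → ℂ) :
    rosenbrock A B C D lam *ᵥ Sum.elim x w =
      Sum.elim (A.map Complex.ofReal *ᵥ x - lam • x + B.map Complex.ofReal *ᵥ w)
        (C.map Complex.ofReal *ᵥ x + D.map Complex.ofReal *ᵥ w) := by
  rw [rosenbrock, fromBlocks_mulVec]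
  simp [sub_mulVec, smul_mulVec]

/-- A zero direction of the cascade splits. With `w = Cm m + Dm v`, the pair `(x, w)` lies in the
kernel of the plant matrix, so both vanish; `w = 0` then puts `(m, v)` in the kernel of the model
matrix. The condition `D * Dm = 0` is what turns the augmented output into `C x + D w`. -/
theorem eq_zero_of_rosenbrock (hDDm : D * Dm = 0)
    (hplant : ∀ lam : ℂ, 0 ≤ lam.re → FullColRank (rosenbrock A B C D lam))
    (hmodel : ∀ lam : ℂ, 0 ≤ lam.re → FullColRank (rosenbrock Am Bm Cm Dm lam))
    {lam : ℂ} (hlam : 0 ≤ lam.re) (u : Fin nx ⊕ Fin nm → ℂ) (v : Fin nv → ℂ)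
    (hu : (augA A B Am Cm).map Complex.ofReal *ᵥ u + (augB B Bm Dm).map Complex.ofReal *ᵥ v =
      lam • u) (hCu : (augC C D Cm).map Complex.ofReal *ᵥ u = 0) : u = 0 := by
  obtain ⟨x, m, rfl⟩ : ∃ x m, u = Sum.elim x m := ⟨u ∘ Sum.inl, u ∘ Sum.inr, by simp⟩
  set w : Fin nw → ℂ := Cm.map Complex.ofReal *ᵥ m + Dm.map Complex.ofReal *ᵥ v with hw
  have hA : (augA A B Am Cm).map Complex.ofReal = fromBlocks (A.map Complex.ofReal)
      (B.map Complex.ofReal * Cm.map Complex.ofReal) 0 (Am.map Complex.ofReal) := by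
    rw [augA, fromBlocks_map, map_ofReal_mul]
    congr 1
  have hB : (augB B Bm Dm).map Complex.ofReal =
      fromRows (B.map Complex.ofReal * Dm.map Complex.ofReal) (Bm.map Complex.ofReal) := by
    rw [augB, ← map_ofReal_mul]
    ext (i | i) j <;> simp
  have hC : (augC C D Cm).map Complex.ofReal =
      fromCols (C.map Complex.ofReal) (D.map Complex.ofReal * Cm.map Complex.ofReal) := by
    rw [augC, ← map_ofReal_mul]
    ext i (j | j) <;> simp
  have hDD : D.map Complex.ofReal * Dm.map Complex.ofReal = 0 := by
    rw [← map_ofReal_mul, hDDm]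
    ext; simp
  rw [hA, hB, fromBlocks_mulVec, fromRows_mulVec] at hu
  rw [hC, fromCols_mulVec] at hCu
  simp only [Sum.elim_comp_inl, Sum.elim_comp_inr, zero_mulVec, zero_add] at hu hCu
  have hx : A.map Complex.ofReal *ᵥ x + B.map Complex.ofReal *ᵥ w = lam • x := by
    ext i
    have := congrFun hu (Sum.inl i)
    simpa [hw, mulVec_add, add_assoc] using this
  have hm : Am.map Complex.ofReal *ᵥ m + Bm.map Complex.ofReal *ᵥ v = lam • m := by
    ext i
    have := congrFun hu (Sum.inr i)
    simpa using this
  have hy : C.map Complex.ofReal *ᵥ x + D.map Complex.ofReal *ᵥ w = 0 := by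
    rw [hw, mulVec_add, mulVec_mulVec, mulVec_mulVec, hDD, zero_mulVec, add_zero, hCu]
  have h1 : Sum.elim x w = 0 := (hplant lam hlam).eq_zero (by
    rw [rosenbrock_mulVec_elim, hy, sub_add_eq_add_sub, hx, sub_self]
    exact Sum.elim_zero_zero)
  have hx0 : x = 0 := funext fun i => congrFun h1 (Sum.inl i)
  have hw0 : w = 0 := funext fun i => congrFun h1 (Sum.inr i)
  have h2 : Sum.elim m v = 0 := (hmodel lam hlam).eq_zero (by
    rw [rosenbrock_mulVec_elim, ← hw, hw0, sub_add_eq_add_sub, hm, sub_self]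
    exact Sum.elim_zero_zero)
  have hm0 : m = 0 := funext fun i => congrFun h2 (Sum.inl i)
  rw [hx0, hm0]
  exact Sum.elim_zero_zero

/-- Stacking as a pair of embeddings. -/
noncomputable def stackL (m n : Type*) [Fintype m] [Fintype n] :
    (EuclideanSpace ℝ m →L[ℝ] EuclideanSpace ℝ (m ⊕ n)) ×
      (EuclideanSpace ℝ n →L[ℝ] EuclideanSpace ℝ (m ⊕ n)) :=
  (LinearMap.toContinuousLinearMap
    { toFun := fun x => stack x 0
      map_add' := fun x y => by ext (i | i) <;> simp [stack]
      map_smul' := fun c x => by ext (i | i) <;> simp [stack] },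
  LinearMap.toContinuousLinearMap
    { toFun := fun y => stack 0 y
      map_add' := fun x y => by ext (i | i) <;> simp [stack]
      map_smul' := fun c x => by ext (i | i) <;> simp [stack] })

theorem HasRate.stack {m n : Type*} [Fintype m] [Fintype n] {t₀ : ℝ}
    {x φ : ℝ → EuclideanSpace ℝ m} {y ψ : ℝ → EuclideanSpace ℝ n} (hx : HasRate t₀ x φ)
    (hy : HasRate t₀ y ψ) :
    HasRate t₀ (fun t => stack (x t) (y t)) (fun t => InputObserver.stack (φ t) (ψ t)) := by
  have hs : ∀ (a : EuclideanSpace ℝ m) (b : EuclideanSpace ℝ n),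
      (stackL m n).1 a + (stackL m n).2 b = InputObserver.stack a b := fun a b => by
    ext (i | i) <;> simp [stackL, InputObserver.stack]
  have := (hx.map (stackL m n).1).add (hy.map (stackL m n).2)
  simpa only [hs] using this

/-- Plant and observer evaluate `gx` and `gy` at the same measured `y`, so the nonlinearities cancel
in the difference. -/
theorem isSolution_error (hDDm : D * Dm = 0) {L : Matrix (Fin nx ⊕ Fin nm) (Fin ny) ℝ}
    {gx : ℝ → EuclideanSpace ℝ (Fin ny) → EuclideanSpace ℝ (Fin nx)}
    {gy : ℝ → EuclideanSpace ℝ (Fin ny) → EuclideanSpace ℝ (Fin ny)} {t₀ : ℝ}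
    {v : ℝ → EuclideanSpace ℝ (Fin nv)} {xm : ℝ → EuclideanSpace ℝ (Fin nm)}
    {w : ℝ → EuclideanSpace ℝ (Fin nw)} {x : ℝ → EuclideanSpace ℝ (Fin nx)}
    {y : ℝ → EuclideanSpace ℝ (Fin ny)} {ξ : ℝ → EuclideanSpace ℝ (Fin nx ⊕ Fin nm)}
    {η : ℝ → EuclideanSpace ℝ (Fin ny)} (hm : IsModelTrajectory Am Bm Cm Dm t₀ v xm w)
    (hp : IsPlantTrajectory A B C D gx gy t₀ w x y)
    (ho : IsObserverTrajectory (augA A B Am Cm) (augC C D Cm) L gx gy t₀ y ξ η) :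
    IsSolution (errorRHS (augA A B Am Cm) (augB B Bm Dm) (augC C D Cm) (D * Dm) L) t₀ v
      (fun t => ξ t - stack (x t) (xm t)) := by
  refine (ho.state.sub (hp.state.stack hm.state)).congr fun t ht => ?_
  have hw := hm.output t ht
  have hη : η t - y t = act (augC C D Cm) (ξ t - stack (x t) (xm t)) := by
    have e : act (augC C D Cm) (stack (x t) (xm t)) = act C (x t) + act D (w t) := by
      ext i
      rw [hw]
      simp only [act, augC, stack, fromCols_mulVec, Sum.elim_comp_inl, Sum.elim_comp_inr,
        PiLp.add_apply, Pi.add_apply, WithLp.ofLp_add, mulVec_add, mulVec_mulVec, hDDm,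
        zero_mulVec, add_zero]
    rw [act_sub, e, ho.output t ht]
    -- The output equation is implicit in `y`: only the free-standing `y t` is expanded, so that the
    -- two `gy t (y t)` terms cancel.
    nth_rw 2 [hp.output t ht]
    abel
  have hA : stack (act A (x t) + gx t (y t) + act B (w t)) (act Am (xm t) + act Bm (v t)) =
      act (augA A B Am Cm) (stack (x t) (xm t)) + stack (gx t (y t)) 0 +
        act (augB B Bm Dm) (v t) := by
    rw [hw]
    ext (i | i) <;>
      simp [act, augA, augB, stack, fromBlocks_mulVec, fromRows_mulVec, mulVec_add, mulVec_mulVec]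
    ring
  have hL : act (augA A B Am Cm + L * augC C D Cm) (ξ t - stack (x t) (xm t)) =
      act (augA A B Am Cm) (ξ t - stack (x t) (xm t)) +
        act L (act (augC C D Cm) (ξ t - stack (x t) (xm t))) := by
    ext i
    simp [act, add_mulVec, mulVec_mulVec]
  simp only [errorRHS]
  rw [hL, hη, hA, hDDm, Matrix.mul_zero, add_zero, act_sub (augA A B Am Cm)]
  abel

end Observer

/-! ### The dissipation inequality for the prescribed gain -/

section Dissipation

variable {n p q z : Type*} [Fintype n] [DecidableEq n] [Fintype p] [Fintype q] [Fintype z]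

/-- With `f = F C x`, the gain contributes `-2 zeta |f|²`, and `Bᵀ P = F C` turns the input term
into `-2 v · f`. The cross term is dominated by completing the square, and the margin `2 (abar - a)
P` pays for the output term. -/
theorem gain_dissipative {A P : Matrix n n ℝ} {B : Matrix n p ℝ} {C : Matrix q n ℝ}
    {Y : Matrix n q ℝ} {F : Matrix p q ℝ} {H : Matrix z n ℝ} {abar a μ γ zeta : ℝ} (hP : P.PosDef)
    (hΦ : (-lmiPhi A C P Y abar).PosSemidef) (hF : Bᵀ * P = F * C) (hμ : 0 < μ) (hγ : 0 < γ)
    (hH : ((2 * (abar - a)) • P - μ • (Hᵀ * H)).PosSemidef) (hz : 1 / (2 * μ * γ ^ 2) ≤ zeta)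
    (x : n → ℝ) (v : p → ℝ) :
    2 * (((A + gain C P Y F zeta * C) *ᵥ x - B *ᵥ v) ⬝ᵥ P *ᵥ x) + 2 * a * (x ⬝ᵥ P *ᵥ x) ≤
      μ * γ ^ 2 * (v ⬝ᵥ v) - μ * ((H *ᵥ x) ⬝ᵥ (H *ᵥ x)) := by
  have hPt : Pᵀ = P := by simpa using hP.1.eq
  have hPP : P * P⁻¹ = 1 := Matrix.mul_nonsing_inv _ ((isUnit_iff_isUnit_det _).1 hP.isUnit)
  set f : p → ℝ := (F * C) *ᵥ x with hf
  have h1 : ((A + gain C P Y F zeta * C) *ᵥ x) ⬝ᵥ P *ᵥ x =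
      x ⬝ᵥ (P * A) *ᵥ x + x ⬝ᵥ (Y * C) *ᵥ x - zeta * (f ⬝ᵥ f) := by
    have e : P * (A + gain C P Y F zeta * C) =
        P * A + Y * C - zeta • ((F * C)ᵀ * (F * C)) := by
      rw [gain, Matrix.mul_add, ← Matrix.mul_assoc, ← Matrix.mul_assoc, hPP, Matrix.one_mul,
        Matrix.sub_mul, Matrix.smul_mul, transpose_mul, ← Matrix.mul_assoc, add_sub_assoc]
    rw [dotProduct_comm, ← vecMul_transpose P x, hPt, ← dotProduct_mulVec, mulVec_mulVec, e, sub_mulVec, add_mulVec, dotProduct_sub, dotProduct_add,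
      smul_mulVec, dotProduct_smul, ← mulVec_mulVec _ (F * C)ᵀ, dotProduct_mulVec x (F * C)ᵀ,
      vecMul_transpose, smul_eq_mul]
  have h2 : (B *ᵥ v) ⬝ᵥ P *ᵥ x = v ⬝ᵥ f := by
    rw [hf, ← hF, ← mulVec_mulVec, dotProduct_mulVec v, vecMul_transpose]
  have h3 : 0 ≤ -(2 * (x ⬝ᵥ (P * A) *ᵥ x) + 2 * (x ⬝ᵥ (Y * C) *ᵥ x) +
      2 * abar * (x ⬝ᵥ P *ᵥ x)) := by
    have h := hΦ.dotProduct_mulVec_nonneg x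
    have htr : ∀ T : Matrix n n ℝ, x ⬝ᵥ Tᵀ *ᵥ x = x ⬝ᵥ T *ᵥ x := fun T => by
      rw [dotProduct_mulVec, vecMul_transpose, dotProduct_comm]
    have e1 : Aᵀ * P = (P * A)ᵀ := by rw [transpose_mul, hPt]
    have e2 : Cᵀ * Yᵀ = (Y * C)ᵀ := (transpose_mul _ _).symm
    rw [star_trivial, lmiPhi, e1, e2, neg_mulVec, dotProduct_neg, add_mulVec, add_mulVec,
      add_mulVec, add_mulVec, dotProduct_add, dotProduct_add, dotProduct_add, dotProduct_add,
      htr, htr, smul_mulVec, dotProduct_smul, smul_eq_mul] at h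
    linarith
  have h4 : 0 ≤ 2 * (abar - a) * (x ⬝ᵥ P *ᵥ x) - μ * ((H *ᵥ x) ⬝ᵥ (H *ᵥ x)) := by
    have h := hH.dotProduct_mulVec_nonneg x
    rw [star_trivial, sub_mulVec, dotProduct_sub, smul_mulVec, smul_mulVec, dotProduct_smul,
      dotProduct_smul, ← mulVec_mulVec, dotProduct_mulVec x Hᵀ, vecMul_transpose] at h
    simpa using h
  have h5 : 0 ≤ μ * γ ^ 2 * (v ⬝ᵥ v) + 2 * (v ⬝ᵥ f) + 2 * zeta * (f ⬝ᵥ f) := by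
    set k := μ * γ ^ 2 with hk
    have hk0 : 0 < k := by positivity
    have hff : 0 ≤ f ⬝ᵥ f := by simpa using dotProduct_star_self_nonneg f
    have hkz : 1 ≤ 2 * zeta * k := by
      rw [div_le_iff₀ (by positivity)] at hz
      rw [hk]; linarith
    have hsq : 0 ≤ (k • v + f) ⬝ᵥ (k • v + f) := by
      simpa using dotProduct_star_self_nonneg (k • v + f)
    rw [add_dotProduct, dotProduct_add, dotProduct_add, smul_dotProduct, smul_dotProduct,
      dotProduct_smul, dotProduct_smul, dotProduct_comm f v] at hsq
    simp only [smul_eq_mul] at hsq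
    -- Multiplied by `k`, the claim is `|k v + f|² ≥ 0` plus `(2 zeta k - 1) |f|² ≥ 0`.
    refine (mul_nonneg_iff_of_pos_left hk0).1 ?_
    have := mul_le_mul_of_nonneg_right hkz hff
    linarith
  rw [sub_dotProduct, h1, h2]
  linarith

end Dissipation

end InputObserver

/-! ### Assembly of the theorem -/

theorem mainTheorem4 {nx nm nw nv ny : ℕ} (A : Matrix (Fin nx) (Fin nx) ℝ)
    (B : Matrix (Fin nx) (Fin nw) ℝ) (C : Matrix (Fin ny) (Fin nx) ℝ)
    (D : Matrix (Fin ny) (Fin nw) ℝ) (Am : Matrix (Fin nm) (Fin nm) ℝ)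
    (Bm : Matrix (Fin nm) (Fin nv) ℝ) (Cm : Matrix (Fin nw) (Fin nm) ℝ)
    (Dm : Matrix (Fin nw) (Fin nv) ℝ) (hDDm : D * Dm = 0)
    (hCB : InputObserver.FullColRank (C * B * Dm + D * Cm * Bm))
    (hplant : ∀ lam : ℂ, 0 ≤ lam.re → InputObserver.FullColRank (InputObserver.rosenbrock A B C D lam))
    (hmodel : ∀ lam : ℂ, 0 ≤ lam.re → InputObserver.FullColRank (InputObserver.rosenbrock Am Bm Cm Dm lam)) :
    (∃ (P : Matrix (Fin nx ⊕ Fin nm) (Fin nx ⊕ Fin nm) ℝ)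
      (Y : Matrix (Fin nx ⊕ Fin nm) (Fin ny) ℝ) (F : Matrix (Fin nv) (Fin ny) ℝ),
      P.PosDef ∧ (-InputObserver.lmiPhi (InputObserver.augA A B Am Cm) (InputObserver.augC C D Cm) P Y 0).PosDef ∧
      (InputObserver.augB B Bm Dm).transpose * P = F * InputObserver.augC C D Cm) ∧
    ∀ (P : Matrix (Fin nx ⊕ Fin nm) (Fin nx ⊕ Fin nm) ℝ)
      (Y : Matrix (Fin nx ⊕ Fin nm) (Fin ny) ℝ) (F : Matrix (Fin nv) (Fin ny) ℝ),
      P.PosDef → (-InputObserver.lmiPhi (InputObserver.augA A B Am Cm) (InputObserver.augC C D Cm) P Y 0).PosDef →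
      (InputObserver.augB B Bm Dm).transpose * P = F * InputObserver.augC C D Cm →
      (∃ abar : ℝ, 0 < abar ∧
        (-InputObserver.lmiPhi (InputObserver.augA A B Am Cm) (InputObserver.augC C D Cm) P Y abar).PosSemidef) ∧
      ∀ abar : ℝ, (-InputObserver.lmiPhi (InputObserver.augA A B Am Cm) (InputObserver.augC C D Cm) P Y abar).PosSemidef →
        ∀ a : ℝ, 0 < a → a < abar →
        ∀ (nz : ℕ) (H : Matrix (Fin nz) (Fin nx ⊕ Fin nm) ℝ) (γ : ℝ), 0 < γ →
          (∃ μ₁ : ℝ, 0 < μ₁ ∧ ((2 * (abar - a)) • P - μ₁ • (H.transpose * H)).PosSemidef) ∧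
          ∀ μ₁ : ℝ, 0 < μ₁ → ((2 * (abar - a)) • P - μ₁ • (H.transpose * H)).PosSemidef →
            ∀ zeta : ℝ, 1 / (2 * μ₁ * γ ^ 2) ≤ zeta →
              InputObserver.ObserverAchieves A B C D Am Bm Cm Dm H
                (InputObserver.gain (InputObserver.augC C D Cm) P Y F zeta) γ := by
  refine ⟨?_, fun P Y F hP hΦ hF => ⟨?_, fun abar habar a ha haa nz H γ hγ => ⟨?_,
    fun μ hμ hH zeta hz => ⟨?_, ?_⟩⟩⟩⟩
  · refine InputObserver.exists_posDef_lmi_of_minimumPhase ?_ fun lam hlam =>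
      InputObserver.eq_zero_of_rosenbrock hDDm hplant hmodel hlam
    rw [InputObserver.augC, InputObserver.augB, Matrix.fromCols_mul_fromRows, ← Matrix.mul_assoc]
    exact hCB
  · obtain ⟨ε, hε, h⟩ := hΦ.exists_posDef_sub_smul hP.1
    -- Half of `ε`, because `lmiPhi` adds `2 * a` times `P`.
    refine ⟨ε / 2, by positivity, ?_⟩
    convert h.posSemidef using 1
    simp only [InputObserver.lmiPhi]
    rw [mul_div_cancel₀ ε two_ne_zero, mul_zero, zero_smul, add_zero, neg_add, ← sub_eq_add_neg]
  · have hP' : ((2 * (abar - a)) • P).PosDef := hP.smul (by linarith)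
    obtain ⟨ε, hε, h⟩ := hP'.exists_posDef_sub_smul
      (by simpa using Matrix.isHermitian_conjTranspose_mul_self H)
    exact ⟨ε, hε, h.posSemidef⟩
  · intro gx gy t₀ v xm w x y ξ η hm hp ho
    exact InputObserver.isSolution_error hDDm hm hp ho
  · unfold InputObserver.errorRHS
    refine InputObserver.isL2Stable_of_dissipative hP ha hμ hγ fun x v => ?_
    rw [hDDm, Matrix.mul_zero, add_zero]
    exact InputObserver.gain_dissipative hP habar hF hμ hγ hH hz x v
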